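/- Let $a<0<b$, let $f\in C^1([a,b])$ and $g\in C^3([a,b])$ with $f(0)=g(0)=0$ and $g'(0)>0$, and suppose that the origin is a center of $x''+f(x)x'+g(x)=0$, i.e. that the origin of the phase plane with coordinates $(x,x')$ is an equilibrium and has a neighborhood in which every other point lies on the orbit of a nonconstant periodic solution. For small $c>0$ let $T(c)$ be the minimal period of the solution with $x(0)=c$, $x'(0)=0$. Put $$Q=g'(0)\,g'''(0)-\tfrac53\,g''(0)^2-\tfrac23\,f'(0)^2\,g'(0).$$ Then there is $\delta>0$ such that $T(c)$ is well defined for all $c\in(0,\delta)$ and the following holds. If $Q\neq0$, then $T$ is strictly monotonic on $(0,\delta)$. More precisely, if $Q<0$, then $T$ is strictly increasing on $(0,\delta)$, and if $Q>0$, then $T$ is strictly decreasing on $(0,\delta)$. -/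

import Mathlib

open Set Filter Topology

/-- `z = (x, x')` is a solution, defined for all times and with `x` staying in the interval `J`
on which `f` and `g` are considered, of the phase plane system of `x'' + f(x) x' + g(x) = 0`,
that is, of `x' = y`, `y' = -f(x) y - g(x)`. -/
def IsPhaseCurve (f g : ℝ → ℝ) (J : Set ℝ) (z : ℝ → ℝ × ℝ) : Prop :=
  ∀ t : ℝ, (z t).1 ∈ J ∧
    HasDerivAt z ((z t).2, -(f (z t).1) * (z t).2 - g (z t).1) t

/-- The origin of the phase plane is a center of `x'' + f(x) x' + g(x) = 0`: it is an equilibrium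
with a neighborhood in which every other point lies on a cycle, that is, on the orbit of a
nonconstant periodic solution. -/
def IsCenterAtOrigin (f g : ℝ → ℝ) (J : Set ℝ) : Prop :=
  IsPhaseCurve f g J (fun _ => (0, 0)) ∧
    ∃ U ∈ 𝓝 ((0, 0) : ℝ × ℝ), ∀ p ∈ U, p ≠ (0, 0) →
      ∃ z : ℝ → ℝ × ℝ, IsPhaseCurve f g J z ∧ z 0 = p ∧
        (∃ t : ℝ, z t ≠ z 0) ∧ ∃ τ : ℝ, 0 < τ ∧ Function.Periodic z τ

/-- The period function: the infimum of the positive periods of the solution that starts at the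
point `(c, 0)` of the phase plane. -/
noncomputable def periodFunction (f g : ℝ → ℝ) (J : Set ℝ) (c : ℝ) : ℝ :=
  sInf {τ : ℝ | 0 < τ ∧ ∃ z : ℝ → ℝ × ℝ,
    IsPhaseCurve f g J z ∧ z 0 = (c, 0) ∧ Function.Periodic z τ}

/-- The quantity `g'(0) g'''(0) - (5/3) g''(0)^2 - (2/3) f'(0)^2 g'(0)`. -/
noncomputable def monotonicityQuantity (f g : ℝ → ℝ) : ℝ :=
  deriv g 0 * iteratedDeriv 3 g 0 - (5 / 3) * (iteratedDeriv 2 g 0) ^ 2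
    - (2 / 3) * (deriv f 0) ^ 2 * deriv g 0

/-! ### A two-sided scalar Grönwall inequality -/

/-! Let m(x) = x⁻² ∫₀ˣ s f(s) ds and ω = √g'(0), pass to X = ωx, Y = x' + x m(x), and multiply time
by ω. The damping then acts as the radial field -β(X)(X, Y). With X = r cos φ, Y = -r sin φ, the
angular speed is 1 + cos²φ H(r cos φ), where β enters only through a summand -β² of H. The time of
one turn is the integral of the reciprocal speed along r(φ). Its first order term is -p₀ cos³φ r(φ);
since cos³ is the derivative of sin - sin³/3, integration by parts along the orbit makes it of
second order. What remains is r² `periodDensity`, with integral 5π/6 p₀² - 3π/4 p₁ = -πQ/(8ω⁶).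

An asymptotic formula for the period at each amplitude would not give monotonicity, so two orbits r
< s are compared. The r-derivative of the integrand is expanded uniformly in φ
(`isLittleO_normalizedTimeRateDeriv`), and by Grönwall s² - r² is almost constant along the orbits
(`exists_sq_sub_sq_close`). Hence the difference of the turn times is the above constant times s(0)²
- r(0)², up to a small fraction of the latter (`exists_turnTime_sub_close`). That a larger c means a
larger r(0) is `exists_lt_of_abscissa_lt`.

The center supplies periodic solutions, but not that they are small or close up after one turn.
Start such a solution at a point of minimal radius: D(φ) = r(φ) - r(φ - 2π) goes from ≤ 0 to ≥ 0 in
one turn, while |D'| ≤ μ|D| forbids a change of sign, so D vanishes and the orbit closes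
(`exists_closing`). Grönwall over a bounded time and uniqueness then keep it small forever
(`exists_small_orbit`). -/

theorem abs_le_exp_mul_abs_left {D D' : ℝ → ℝ} {μ p q : ℝ} (hpq : p ≤ q)
    (hD : ∀ t ∈ Icc p q, HasDerivAt D (D' t) t) (hμ : ∀ t ∈ Icc p q, |D' t| ≤ μ * |D t|) :
    |D q| ≤ |D p| * Real.exp (μ * (q - p)) := by
  have h := norm_le_gronwallBound_of_norm_deriv_right_le (f := D) (f' := D') (δ := |D p|) (K := μ)
    (ε := 0) (a := p) (b := q) (fun t ht => (hD t ht).continuousAt.continuousWithinAt)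
    (fun t ht => (hD t (Ico_subset_Icc_self ht)).hasDerivWithinAt) le_rfl
    (fun t ht => by simpa using hμ t (Ico_subset_Icc_self ht)) q ⟨hpq, le_rfl⟩
  simpa [gronwallBound_ε0] using h

/-- Time reversal of the forward estimate. -/
theorem abs_le_exp_mul_abs_right {D D' : ℝ → ℝ} {μ p q : ℝ} (hpq : p ≤ q)
    (hD : ∀ t ∈ Icc p q, HasDerivAt D (D' t) t) (hμ : ∀ t ∈ Icc p q, |D' t| ≤ μ * |D t|) :
    |D p| ≤ |D q| * Real.exp (μ * (q - p)) := by
  have h := abs_le_exp_mul_abs_left (D := fun t => D (-t)) (D' := fun t => - D' (-t)) (μ := μ)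
    (p := -q) (q := -p) (by linarith)
    (fun t ht => by
      have h1 := hD (-t) ⟨by linarith [ht.2], by linarith [ht.1]⟩
      exact (h1.scomp t (hasDerivAt_neg t)).congr_deriv (by simp))
    (fun t ht => by
      simpa using hμ (-t) ⟨by linarith [ht.2], by linarith [ht.1]⟩)
  simp only [neg_neg] at h
  convert h using 3
  ring

/-- A solution of a differential inequality `|D'| ≤ μ |D|` does not change its sign. -/
theorem eq_zero_of_nonpos_of_nonneg {D D' : ℝ → ℝ} {μ p q : ℝ} (hpq : p ≤ q)
    (hD : ∀ t ∈ Icc p q, HasDerivAt D (D' t) t) (hμ : ∀ t ∈ Icc p q, |D' t| ≤ μ * |D t|)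
    (hp : D p ≤ 0) (hq : 0 ≤ D q) : D p = 0 := by
  have hc : ContinuousOn D (Icc p q) := fun t ht => (hD t ht).continuousAt.continuousWithinAt
  -- D has a zero in between, and the backward estimate carries it to the left endpoint.
  obtain ⟨s, hs, h0⟩ := intermediate_value_Icc hpq hc ⟨hp, hq⟩
  have h := abs_le_exp_mul_abs_right (q := s) hs.1 (fun t ht => hD t ⟨ht.1, ht.2.trans hs.2⟩)
    (fun t ht => hμ t ⟨ht.1, ht.2.trans hs.2⟩)
  rw [h0] at h
  simpa using h

/-! ### The system in polar coordinates -/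

/-- `x ↦ 1 + H x` and `β` are the coefficients of the system `X' = Y - X β(X)`,
`Y' = -X (1 + H(X)) - β(X) Y`. Along its orbits, in the polar coordinates `X = r cos φ`,
`Y = -r sin φ`, one has `dr/dφ = - r * radialRate H β φ r`. -/
noncomputable def radialRate (H β : ℝ → ℝ) (φ r : ℝ) : ℝ :=
  (β (r * Real.cos φ) - Real.sin φ * Real.cos φ * H (r * Real.cos φ)) /
    (1 + Real.cos φ ^ 2 * H (r * Real.cos φ))

/-- The derivative of the time with respect to the polar angle. -/
noncomputable def timeRate (H : ℝ → ℝ) (φ r : ℝ) : ℝ :=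
  1 / (1 + Real.cos φ ^ 2 * H (r * Real.cos φ))

/-- The behavior of the coefficients of the system near the origin. -/
structure LocalExpansion (H β H' β' : ℝ → ℝ) (p₀ p₁ q₀ : ℝ) : Prop where
  H_zero : H 0 = 0
  β_zero : β 0 = 0
  hasDerivAt_H : ∀ᶠ x in 𝓝 0, HasDerivAt H (H' x) x
  hasDerivAt_β : ∀ᶠ x in 𝓝 0, HasDerivAt β (β' x) x
  isLittleO_H' : (fun x => H' x - p₀ - 2 * p₁ * x) =o[𝓝 0] fun x => x
  tendsto_β' : Tendsto β' (𝓝 0) (𝓝 q₀)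

/-- The derivative of `radialRate` with respect to the radius. -/
noncomputable def radialRateDeriv (H β H' β' : ℝ → ℝ) (φ r : ℝ) : ℝ :=
  Real.cos φ * ((β' (r * Real.cos φ) - Real.sin φ * Real.cos φ * H' (r * Real.cos φ)) *
      timeRate H φ r -
    (β (r * Real.cos φ) - Real.sin φ * Real.cos φ * H (r * Real.cos φ)) *
      (Real.cos φ ^ 2 * H' (r * Real.cos φ)) * timeRate H φ r ^ 2)

theorem abs_mul_cos_le {r : ℝ} (hr : 0 ≤ r) (φ : ℝ) : |r * Real.cos φ| ≤ r := by
  rw [abs_mul, abs_of_nonneg hr]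
  exact mul_le_of_le_one_right hr (Real.abs_cos_le_one φ)

theorem one_half_le_one_add {k : ℝ} (hk : |k| ≤ 1 / 2) (φ : ℝ) :
    1 / 2 ≤ 1 + Real.cos φ ^ 2 * k := by
  have h1 : Real.cos φ ^ 2 ≤ 1 := Real.cos_sq_le_one φ
  have h2 := abs_le.1 hk
  nlinarith [sq_nonneg (Real.cos φ)]

theorem hasDerivAt_radialRate {H β H' β' : ℝ → ℝ} {φ r : ℝ}
    (hH : HasDerivAt H (H' (r * Real.cos φ)) (r * Real.cos φ))
    (hβ : HasDerivAt β (β' (r * Real.cos φ)) (r * Real.cos φ))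
    (h0 : 1 + Real.cos φ ^ 2 * H (r * Real.cos φ) ≠ 0) :
    HasDerivAt (radialRate H β φ) (radialRateDeriv H β H' β' φ r) r := by
  have hx : HasDerivAt (fun r : ℝ => r * Real.cos φ) (Real.cos φ) r := hasDerivAt_mul_const _
  have h1 := hH.comp r hx
  have h2 := hβ.comp r hx
  have h3 := (h2.sub (h1.const_mul (Real.sin φ * Real.cos φ))).div
    ((h1.const_mul (Real.cos φ ^ 2)).const_add 1) h0
  refine h3.congr_deriv ?_
  simp only [radialRateDeriv, timeRate, Function.comp, Pi.sub_apply]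
  field_simp

theorem hasDerivAt_timeRate {H H' : ℝ → ℝ} {φ r : ℝ}
    (hH : HasDerivAt H (H' (r * Real.cos φ)) (r * Real.cos φ))
    (h0 : 1 + Real.cos φ ^ 2 * H (r * Real.cos φ) ≠ 0) :
    HasDerivAt (timeRate H φ)
      (-(Real.cos φ ^ 3 * H' (r * Real.cos φ)) * timeRate H φ r ^ 2) r := by
  have hx : HasDerivAt (fun r : ℝ => r * Real.cos φ) (Real.cos φ) r := hasDerivAt_mul_const _
  have h1 := hH.comp r hx
  have h3 := (hasDerivAt_const r (1:ℝ)).div ((h1.const_mul (Real.cos φ ^ 2)).const_add 1) h0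
  refine h3.congr_deriv ?_
  simp only [timeRate, Function.comp]
  field_simp
  ring

namespace LocalExpansion

variable {H β H' β' : ℝ → ℝ} {p₀ p₁ q₀ : ℝ}

theorem H'_zero (h : LocalExpansion H β H' β' p₀ p₁ q₀) : H' 0 = p₀ := by
  -- A function that is o(x) along `𝓝 0` vanishes at 0 itself, so the expansion already contains the
  -- value at the origin.
  have h1 := Asymptotics.isLittleO_pure.1 (h.isLittleO_H'.mono (pure_le_nhds 0))
  linarith

theorem β'_zero (h : LocalExpansion H β H' β' p₀ p₁ q₀) : β' 0 = q₀ :=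
  tendsto_nhds_unique (tendsto_pure_nhds β' 0) (h.tendsto_β'.mono_left (pure_le_nhds 0))

theorem isLittleO_H (h : LocalExpansion H β H' β' p₀ p₁ q₀) :
    (fun x => H x - p₀ * x) =o[𝓝 0] fun x => x := by
  have h1 := hasDerivAt_iff_isLittleO.1 h.hasDerivAt_H.self_of_nhds
  simpa [h.H_zero, h.H'_zero, mul_comm] using h1

theorem isLittleO_β (h : LocalExpansion H β H' β' p₀ p₁ q₀) :
    (fun x => β x - q₀ * x) =o[𝓝 0] fun x => x := by
  have h1 := hasDerivAt_iff_isLittleO.1 h.hasDerivAt_β.self_of_nhds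
  simpa [h.β_zero, h.β'_zero, mul_comm] using h1

theorem tendsto_H' (h : LocalExpansion H β H' β' p₀ p₁ q₀) : Tendsto H' (𝓝 0) (𝓝 p₀) := by
  have h1 : Tendsto (fun x : ℝ => x) (𝓝 0) (𝓝 0) := tendsto_id
  have h2 := h.isLittleO_H'.trans_tendsto h1
  have h3 := (h2.add (h1.const_mul (2 * p₁))).add_const p₀
  simpa using h3

theorem isBigO_H (h : LocalExpansion H β H' β' p₀ p₁ q₀) : H =O[𝓝 0] fun x => x := by
  have h1 := h.isLittleO_H.isBigO.add ((Asymptotics.isBigO_refl (fun x : ℝ => x) (𝓝 0)).const_mul_left p₀)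
  simpa using h1

theorem isBigO_β (h : LocalExpansion H β H' β' p₀ p₁ q₀) : β =O[𝓝 0] fun x => x := by
  have h1 := h.isLittleO_β.isBigO.add ((Asymptotics.isBigO_refl (fun x : ℝ => x) (𝓝 0)).const_mul_left q₀)
  simpa using h1

/-- Uniform bounds for the coefficients on a neighborhood of the origin. -/
theorem exists_bounds (h : LocalExpansion H β H' β' p₀ p₁ q₀) :
    ∃ C > 0, ∃ η > 0, ∀ x, |x| ≤ η → HasDerivAt H (H' x) x ∧ HasDerivAt β (β' x) x ∧
      |H x| ≤ 1 / 2 ∧ |H x| ≤ C * |x| ∧ |β x| ≤ C * |x| ∧ |H' x| ≤ C ∧ |β' x| ≤ C := by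
  obtain ⟨C₁, hC₁⟩ := h.isBigO_H.bound
  obtain ⟨C₂, hC₂⟩ := h.isBigO_β.bound
  have h3 : ∀ᶠ x in 𝓝 0, |H' x| < |p₀| + 1 := h.tendsto_H'.abs.eventually_lt_const (by linarith)
  have h4 : ∀ᶠ x in 𝓝 0, |β' x| < |q₀| + 1 := h.tendsto_β'.abs.eventually_lt_const (by linarith)
  have h5 : ∀ᶠ x in 𝓝 0, |H x| < 1 / 2 := by
    have := h.hasDerivAt_H.self_of_nhds.continuousAt.tendsto.abs
    rw [h.H_zero, abs_zero] at this
    exact this.eventually_lt_const (by norm_num)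
  have h6 := (((((h.hasDerivAt_H.and h.hasDerivAt_β).and h5).and hC₁).and hC₂).and h3).and h4
  obtain ⟨η, hη, h7⟩ := Metric.eventually_nhds_iff.1 h6
  refine ⟨|C₁| + |C₂| + (|p₀| + 1) + (|q₀| + 1), by positivity, η / 2, by linarith, fun x hx => ?_⟩
  obtain ⟨⟨⟨⟨⟨⟨a1, a2⟩, a3⟩, a4⟩, a5⟩, a6⟩, a7⟩ := h7 (y := x) (by
    rw [Real.dist_eq, sub_zero]; linarith)
  rw [Real.norm_eq_abs, Real.norm_eq_abs] at a4 a5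
  have b1 := abs_nonneg C₁
  have b2 := abs_nonneg C₂
  have b3 := abs_nonneg p₀
  have b4 := abs_nonneg q₀
  refine ⟨a1, a2, a3.le, a4.trans ?_, a5.trans ?_, by linarith, by linarith⟩
  · exact mul_le_mul_of_nonneg_right (by linarith [le_abs_self C₁]) (abs_nonneg x)
  · exact mul_le_mul_of_nonneg_right (by linarith [le_abs_self C₂]) (abs_nonneg x)

end LocalExpansion

/-! ### Second order expansion of the time rate -/

/-- The quadratic coefficient of the radial expansion of the period integrand. -/
noncomputable def periodDensity (p₀ p₁ q₀ φ : ℝ) : ℝ :=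
  Real.cos φ ^ 6 * p₀ ^ 2 - Real.cos φ ^ 4 * p₁ -
    p₀ * (Real.sin φ - Real.sin φ ^ 3 / 3) * (Real.cos φ * (q₀ - Real.sin φ * Real.cos φ * p₀))

/-- The time rate, up to a constant and up to the derivative of
`φ ↦ p₀ (sin φ - sin³ φ / 3) r(φ)` along orbits. -/
noncomputable def normalizedTimeRate (H β : ℝ → ℝ) (p₀ φ r : ℝ) : ℝ :=
  timeRate H φ r - 1 + p₀ * Real.cos φ ^ 3 * r -
    p₀ * (Real.sin φ - Real.sin φ ^ 3 / 3) * (r * radialRate H β φ r)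

/-- The derivative of `normalizedTimeRate` with respect to the radius. -/
noncomputable def normalizedTimeRateDeriv (H β H' β' : ℝ → ℝ) (p₀ φ r : ℝ) : ℝ :=
  -(Real.cos φ ^ 3 * H' (r * Real.cos φ)) * timeRate H φ r ^ 2 + p₀ * Real.cos φ ^ 3 -
    p₀ * (Real.sin φ - Real.sin φ ^ 3 / 3) *
      (radialRate H β φ r + r * radialRateDeriv H β H' β' φ r)

theorem hasDerivAt_normalizedTimeRate {H β H' β' : ℝ → ℝ} {φ r : ℝ} (p₀ : ℝ)
    (hH : HasDerivAt H (H' (r * Real.cos φ)) (r * Real.cos φ))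
    (hβ : HasDerivAt β (β' (r * Real.cos φ)) (r * Real.cos φ))
    (h0 : 1 + Real.cos φ ^ 2 * H (r * Real.cos φ) ≠ 0) :
    HasDerivAt (normalizedTimeRate H β p₀ φ) (normalizedTimeRateDeriv H β H' β' p₀ φ r) r := by
  have h1 := hasDerivAt_timeRate hH h0
  have h2 := hasDerivAt_radialRate hH hβ h0
  have h3 := ((h1.sub_const 1).add ((hasDerivAt_id r).const_mul (p₀ * Real.cos φ ^ 3))).sub
    (((hasDerivAt_id r).mul h2).const_mul (p₀ * (Real.sin φ - Real.sin φ ^ 3 / 3)))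
  refine h3.congr_deriv ?_
  simp [normalizedTimeRateDeriv]

section expansion

open Asymptotics

variable {H β H' β' : ℝ → ℝ} {p₀ p₁ q₀ : ℝ}

/-- Expanding the derivative instead of the function is what allows two nearby orbits to be
subtracted later. The first order term of the time rate is cancelled by the added p₀ cos³φ r. -/
theorem LocalExpansion.isLittleO_normalizedTimeRateDeriv
    (h : LocalExpansion H β H' β' p₀ p₁ q₀) :
    (fun v : ℝ × ℝ => normalizedTimeRateDeriv H β H' β' p₀ v.1 v.2 -
      2 * periodDensity p₀ p₁ q₀ v.1 * v.2) =o[(⊤ : Filter ℝ) ×ˢ 𝓝 0] fun v => v.2 := by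
  -- The factor `⊤` makes every estimate uniform in the angle.
  set l : Filter (ℝ × ℝ) := (⊤ : Filter ℝ) ×ˢ 𝓝 0 with hl
  have hr : Tendsto (fun v : ℝ × ℝ => v.2) l (𝓝 0) := tendsto_snd
  have hr1 : (fun v : ℝ × ℝ => v.2) =o[l] (fun _ => (1 : ℝ)) := (isLittleO_one_iff ℝ).2 hr
  have hc : (fun v : ℝ × ℝ => Real.cos v.1) =O[l] (fun _ => (1 : ℝ)) :=
    IsBigO.of_bound 1 (Eventually.of_forall fun v => by simpa using Real.abs_cos_le_one v.1)
  have hs : (fun v : ℝ × ℝ => Real.sin v.1) =O[l] (fun _ => (1 : ℝ)) :=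
    IsBigO.of_bound 1 (Eventually.of_forall fun v => by simpa using Real.abs_sin_le_one v.1)
  have bm : ∀ {F G : ℝ × ℝ → ℝ}, F =O[l] (fun _ => (1 : ℝ)) → G =O[l] (fun _ => (1 : ℝ)) →
      (fun v => F v * G v) =O[l] (fun _ => (1 : ℝ)) := fun hF hG => by simpa using hF.mul hG
  have om : ∀ {F G : ℝ × ℝ → ℝ}, F =O[l] (fun _ => (1 : ℝ)) → G =o[l] (fun v => v.2) →
      (fun v => F v * G v) =o[l] (fun v => v.2) := fun hF hG => by simpa using hF.mul_isLittleO hG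
  have ob : ∀ {F G : ℝ × ℝ → ℝ}, F =o[l] (fun _ => (1 : ℝ)) → G =O[l] (fun v => v.2) →
      (fun v => F v * G v) =o[l] (fun v => v.2) := fun hF hG => by simpa using hF.mul_isBigO hG
  have o1 : ∀ {F G : ℝ × ℝ → ℝ}, F =O[l] (fun _ => (1 : ℝ)) → G =o[l] (fun _ => (1 : ℝ)) →
      (fun v => F v * G v) =o[l] (fun _ => (1 : ℝ)) :=
    fun hF hG => by simpa using hF.mul_isLittleO hG
  have bp : ∀ {F : ℝ × ℝ → ℝ} (n : ℕ), F =O[l] (fun _ => (1 : ℝ)) →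
      (fun v => F v ^ n) =O[l] (fun _ => (1 : ℝ)) := fun n hF => by simpa using hF.pow n
  have bc : ∀ a : ℝ, (fun _ : ℝ × ℝ => a) =O[l] (fun _ => (1 : ℝ)) := fun a =>
    isBigO_const_const a one_ne_zero l
  have hxr : (fun v : ℝ × ℝ => v.2 * Real.cos v.1) =O[l] (fun v => v.2) := by
    simpa using (isBigO_refl (fun v : ℝ × ℝ => v.2) l).mul hc
  have hx : Tendsto (fun v : ℝ × ℝ => v.2 * Real.cos v.1) l (𝓝 0) := hxr.trans_tendsto hr
  have e1 : (fun v : ℝ × ℝ => H' (v.2 * Real.cos v.1) - p₀ - 2 * p₁ * (v.2 * Real.cos v.1))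
      =o[l] (fun v => v.2) := (h.isLittleO_H'.comp_tendsto hx).trans_isBigO hxr
  have e2 : (fun v : ℝ × ℝ => H (v.2 * Real.cos v.1) - p₀ * (v.2 * Real.cos v.1))
      =o[l] (fun v => v.2) := (h.isLittleO_H.comp_tendsto hx).trans_isBigO hxr
  have e3 : (fun v : ℝ × ℝ => β (v.2 * Real.cos v.1) - q₀ * (v.2 * Real.cos v.1))
      =o[l] (fun v => v.2) := (h.isLittleO_β.comp_tendsto hx).trans_isBigO hxr
  have e4 : (fun v : ℝ × ℝ => β' (v.2 * Real.cos v.1) - q₀) =o[l] (fun _ => (1 : ℝ)) := by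
    rw [isLittleO_one_iff]
    simpa using (h.tendsto_β'.comp hx).sub_const q₀
  have e5 : (fun v : ℝ × ℝ => H' (v.2 * Real.cos v.1) - p₀) =o[l] (fun _ => (1 : ℝ)) := by
    rw [isLittleO_one_iff]
    simpa using (h.tendsto_H'.comp hx).sub_const p₀
  have hH : (fun v : ℝ × ℝ => H (v.2 * Real.cos v.1)) =O[l] (fun v => v.2) :=
    (h.isBigO_H.comp_tendsto hx).trans hxr
  have hβ : (fun v : ℝ × ℝ => β (v.2 * Real.cos v.1)) =O[l] (fun v => v.2) :=
    (h.isBigO_β.comp_tendsto hx).trans hxr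
  have hH1 := hH.trans_isLittleO hr1
  have hβ1 := hβ.trans_isLittleO hr1
  have hH' : (fun v : ℝ × ℝ => H' (v.2 * Real.cos v.1)) =O[l] (fun _ => (1 : ℝ)) := by
    simpa using e5.isBigO.add (bc p₀)
  have hβ' : (fun v : ℝ × ℝ => β' (v.2 * Real.cos v.1)) =O[l] (fun _ => (1 : ℝ)) := by
    simpa using e4.isBigO.add (bc q₀)
  have hκ : ∀ᶠ v : ℝ × ℝ in l, |H (v.2 * Real.cos v.1)| ≤ 1 / 2 := by
    have h1 : Tendsto (fun v : ℝ × ℝ => |H (v.2 * Real.cos v.1)|) l (𝓝 0) := by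
      simpa using ((isLittleO_one_iff ℝ).1 hH1).abs
    exact h1.eventually_le_const (by norm_num)
  have hk : (fun v : ℝ × ℝ => timeRate H v.1 v.2) =O[l] (fun _ => (1 : ℝ)) := by
    refine IsBigO.of_bound 2 (hκ.mono fun v hv => ?_)
    have h1 := one_half_le_one_add hv v.1
    rw [timeRate, norm_div, Real.norm_of_nonneg (by linarith : (0:ℝ) ≤ 1 + _), norm_one, mul_one,
      div_le_iff₀ (by linarith)]
    linarith
  have hS : (fun v : ℝ × ℝ => p₀ * (Real.sin v.1 - Real.sin v.1 ^ 3 / 3)) =O[l]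
      (fun _ => (1 : ℝ)) := by
    refine bm (bc p₀) (hs.sub ?_)
    simpa [div_eq_mul_inv] using bm (bp 3 hs) (bc 3⁻¹)
  have hw : (fun v : ℝ × ℝ => β (v.2 * Real.cos v.1) -
      Real.sin v.1 * Real.cos v.1 * H (v.2 * Real.cos v.1)) =O[l] (fun v => v.2) := by
    refine hβ.sub ?_
    simpa using (bm hs hc).mul hH
  have hw1 := hw.trans_isLittleO hr1
  have hrr := isBigO_refl (fun v : ℝ × ℝ => v.2) l
  -- With k the time rate and u = cos²φ H: `t1` to `t4` come from k² = 1 - 2u + (3u² + 2u³)k², `t5`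
  -- to `t7` from k = 1 - uk in the radial rate, and `t8` to `t11` from r times its derivative.
  have t1 := om (bp 3 hc) e1
  have t2 := om (bm (bc (2 * p₀)) (bp 5 hc)) e2
  have t3 := om (bm (bc 2) (bp 5 hc)) (ob e5 hH)
  have t4 := om (bm (bm (bp 7 hc) hH') (bm ((bc 3).add (bm (bc 2) (bm (bp 2 hc) hH1.isBigO)))
    (bp 2 hk))) (ob hH1 hH)
  have t5 := om hS e3
  have t6 := om (bm hS (bm hs hc)) e2
  have t7 := om (bm (bm hS (bp 2 hc)) hk) (ob hw1 hH)
  have t8 := om (bm hS hc) (ob e4 hrr)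
  have t9 := om (bm hS (bm hc (bm hs hc))) (ob e5 hrr)
  have t10 := om (bm (bm hS (bp 3 hc)) (bm hk (hβ'.sub (bm (bm hs hc) hH')))) (ob hH1 hrr)
  have t11 := om (bm (bm hS (bp 3 hc)) (bm hH' (bp 2 hk))) (ob hw1 hrr)
  have key := (((t2.sub t1).add t3).sub t4).sub ((((((t5.sub t6).sub t7).add t8).sub t9).sub
    t10).sub t11)
  refine key.congr' (hκ.mono fun v hv => ?_) EventuallyEq.rfl
  have h1 := one_half_le_one_add hv v.1
  -- The only relation between the quantities generalized below; modulo it the claim is a polynomial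
  -- identity.
  have hk1 : timeRate H v.1 v.2 * (1 + Real.cos v.1 ^ 2 * H (v.2 * Real.cos v.1)) = 1 := by
    rw [timeRate, one_div, inv_mul_cancel₀ (by linarith)]
  simp only [normalizedTimeRateDeriv, radialRateDeriv, radialRate, periodDensity]
  have hdiv : ∀ a, a / (1 + Real.cos v.1 ^ 2 * H (v.2 * Real.cos v.1)) = a * timeRate H v.1 v.2 :=
    fun a => by rw [timeRate, mul_one_div]
  rw [hdiv]
  clear hdiv
  generalize timeRate H v.1 v.2 = k at *
  generalize H (v.2 * Real.cos v.1) = η at *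
  generalize H' (v.2 * Real.cos v.1) = η' at *
  generalize β (v.2 * Real.cos v.1) = b at *
  generalize β' (v.2 * Real.cos v.1) = b' at *
  generalize Real.cos v.1 = c at *
  generalize Real.sin v.1 = s at *
  linear_combination (c ^ 3 * η' * (1 - 2 * (c ^ 2 * η)) * (k * (1 + c ^ 2 * η) + 1) +
    p₀ * (s - s ^ 3 / 3) * (b - s * c * η + v.2 * c * (b' - s * c * η'))) * hk1

end expansion

/-! ### Comparison of closed orbits -/

/-- A solution of `|D'| ≤ μ |D|` that is nonpositive somewhere is nonpositive everywhere. -/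
theorem nonpos_of_abs_deriv_le {D D' : ℝ → ℝ} {μ s : ℝ} (hD : ∀ t, HasDerivAt D (D' t) t)
    (hμ : ∀ t, |D' t| ≤ μ * |D t|) (hs : D s ≤ 0) (t : ℝ) : D t ≤ 0 := by
  by_contra! ht
  rcases le_total s t with hst | hts
  · have h0 := eq_zero_of_nonpos_of_nonneg hst (fun t _ => hD t) (fun t _ => hμ t) hs ht.le
    have h1 := abs_le_exp_mul_abs_left hst (fun t _ => hD t) (fun t _ => hμ t)
    rw [h0, abs_zero, zero_mul] at h1
    linarith [le_abs_self (D t)]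
  · have h0 := eq_zero_of_nonpos_of_nonneg (D := fun t => - D t) (D' := fun t => - D' t) hts
      (fun t _ => (hD t).neg) (fun t _ => by simpa using hμ t) (by linarith) (by linarith)
    linarith

/-- A `2π`-periodic positive solution, of size at most `η`, of the orbit equation in polar
coordinates. -/
def IsPolarOrbit (H β : ℝ → ℝ) (η : ℝ) (r : ℝ → ℝ) : Prop :=
  ∀ φ, 0 < r φ ∧ r φ ≤ η ∧ HasDerivAt r (-(r φ * radialRate H β φ (r φ))) φ ∧
    r (φ + 2 * Real.pi) = r φ

theorem abs_arctan_sub_arctan_le (x y : ℝ) : |Real.arctan x - Real.arctan y| ≤ |x - y| := by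
  have h := convex_univ.norm_image_sub_le_of_norm_hasDerivWithin_le (f := Real.arctan) (C := 1)
    (fun z _ => (Real.hasDerivAt_arctan z).hasDerivWithinAt)
    (fun z _ => by
      rw [Real.norm_of_nonneg (by positivity), div_le_one (by positivity)]
      nlinarith [sq_nonneg z]) (mem_univ y) (mem_univ x)
  simpa using h

namespace LocalExpansion

variable {H β H' β' : ℝ → ℝ} {p₀ p₁ q₀ : ℝ}

/-- Since β and H vanish at the origin, the radial rate is O(r), while its derivative is merely
bounded. Together they make the derivative of r times the radial rate O(r), hence the small
Lipschitz constant below. -/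
theorem exists_radial_bounds (h : LocalExpansion H β H' β' p₀ p₁ q₀) :
    ∃ M > 0, ∃ η > 0, ∀ φ r, 0 ≤ r → r ≤ η →
      HasDerivAt (radialRate H β φ) (radialRateDeriv H β H' β' φ r) r ∧
      HasDerivAt (normalizedTimeRate H β p₀ φ) (normalizedTimeRateDeriv H β H' β' p₀ φ r) r ∧
      |radialRate H β φ r| ≤ M * r ∧ |radialRateDeriv H β H' β' φ r| ≤ M ∧
      |H (r * Real.cos φ)| ≤ 1 / 2 := by
  obtain ⟨C, hC, η, hη, hb⟩ := h.exists_bounds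
  -- 4C is the numerator bound 2C (per unit of r, or for its derivative) times the bound 2 of the
  -- time rate; 8C²η bounds the term from differentiating the denominator.
  refine ⟨4 * C + 8 * C ^ 2 * η, by positivity, η, hη, fun φ r hr hrη => ?_⟩
  have hx := abs_mul_cos_le hr φ
  obtain ⟨a1, a2, a3, a4, a5, a6, a7⟩ := hb _ (hx.trans hrη)
  have h1 := one_half_le_one_add a3 φ
  have h0 : 1 + Real.cos φ ^ 2 * H (r * Real.cos φ) ≠ 0 := by linarith
  refine ⟨hasDerivAt_radialRate a1 a2 h0, hasDerivAt_normalizedTimeRate p₀ a1 a2 h0, ?_, ?_, a3⟩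
  all_goals
    have hk : |timeRate H φ r| ≤ 2 := by
      rw [timeRate, abs_div, abs_one, abs_of_nonneg (by linarith : (0:ℝ) ≤ 1 + _),
        div_le_iff₀ (by linarith)]
      linarith
    have hc := Real.abs_cos_le_one φ
    have hs := Real.abs_sin_le_one φ
    have hsc : |Real.sin φ * Real.cos φ| ≤ 1 := by
      rw [abs_mul]; exact mul_le_one₀ hs (abs_nonneg _) hc
    have hCr : C * |r * Real.cos φ| ≤ C * r := mul_le_mul_of_nonneg_left hx hC.le
    have hw : |β (r * Real.cos φ) - Real.sin φ * Real.cos φ * H (r * Real.cos φ)| ≤ 2 * (C * r) := by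
      refine (abs_sub _ _).trans ?_
      have : |Real.sin φ * Real.cos φ * H (r * Real.cos φ)| ≤ 1 * (C * r) := by
        rw [abs_mul]
        exact mul_le_mul hsc (a4.trans hCr) (abs_nonneg _) zero_le_one
      linarith
  · have : radialRate H β φ r = (β (r * Real.cos φ) -
        Real.sin φ * Real.cos φ * H (r * Real.cos φ)) * timeRate H φ r := by
      rw [radialRate, timeRate, mul_one_div]
    rw [this, abs_mul]
    have h2 := mul_le_mul hw hk (abs_nonneg _) (by positivity)
    have h3 : 0 ≤ 8 * C ^ 2 * η * r := by positivity
    linarith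
  · have hw' : |β' (r * Real.cos φ) - Real.sin φ * Real.cos φ * H' (r * Real.cos φ)| ≤ 2 * C := by
      refine (abs_sub _ _).trans ?_
      have : |Real.sin φ * Real.cos φ * H' (r * Real.cos φ)| ≤ 1 * C := by
        rw [abs_mul]
        exact mul_le_mul hsc a6 (abs_nonneg _) zero_le_one
      linarith
    have hk2 : |timeRate H φ r ^ 2| ≤ 4 := by
      rw [abs_pow]
      nlinarith [abs_nonneg (timeRate H φ r)]
    have hc2 : |Real.cos φ ^ 2 * H' (r * Real.cos φ)| ≤ C := by
      rw [abs_mul, abs_pow]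
      nlinarith [abs_nonneg (Real.cos φ), abs_nonneg (H' (r * Real.cos φ)),
        pow_le_one₀ (n := 2) (abs_nonneg (Real.cos φ)) hc]
    rw [radialRateDeriv, abs_mul]
    have e1 : |(β' (r * Real.cos φ) - Real.sin φ * Real.cos φ * H' (r * Real.cos φ)) *
        timeRate H φ r| ≤ 2 * C * 2 := by
      rw [abs_mul]
      exact mul_le_mul hw' hk (abs_nonneg _) (by positivity)
    have e2 : |(β (r * Real.cos φ) - Real.sin φ * Real.cos φ * H (r * Real.cos φ)) *
        (Real.cos φ ^ 2 * H' (r * Real.cos φ)) * timeRate H φ r ^ 2| ≤ 2 * (C * r) * C * 4 := by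
      rw [abs_mul, abs_mul]
      exact mul_le_mul (mul_le_mul hw hc2 (abs_nonneg _) (by positivity)) hk2 (abs_nonneg _)
        (by positivity)
    have e3 : 2 * (C * r) * C * 4 ≤ 8 * C ^ 2 * η := by
      have := mul_le_mul_of_nonneg_left hrη (by positivity : 0 ≤ 8 * C ^ 2)
      linarith
    refine (mul_le_of_le_one_left (abs_nonneg _) hc).trans ((abs_sub _ _).trans ?_)
    linarith

/-- The right hand side of the orbit equation is Lipschitz with a small constant near `0`. -/
theorem exists_radial_lipschitz (h : LocalExpansion H β H' β' p₀ p₁ q₀) :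
    ∃ M > 0, ∃ η > 0, ∀ ρ ≤ η, ∀ φ, ∀ r ∈ Icc 0 ρ, ∀ s ∈ Icc 0 ρ,
      |s * radialRate H β φ s - r * radialRate H β φ r| ≤ M * ρ * |s - r| ∧
      |radialRate H β φ r| ≤ M * ρ ∧ |H (r * Real.cos φ)| ≤ 1 / 2 := by
  obtain ⟨M, hM, η, hη, hb⟩ := h.exists_radial_bounds
  refine ⟨2 * M, by positivity, η, hη, fun ρ hρ φ r hr s hs => ?_⟩
  refine ⟨?_, ?_, (hb φ r hr.1 (hr.2.trans hρ)).2.2.2.2⟩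
  · refine (convex_Icc 0 ρ).norm_image_sub_le_of_norm_hasDerivWithin_le
      (f := fun r => r * radialRate H β φ r)
      (fun z hz => ((hasDerivAt_id z).mul (hb φ z hz.1 (hz.2.trans hρ)).1).hasDerivWithinAt)
      (fun z hz => ?_) hr hs
    obtain ⟨-, -, a1, a2, -⟩ := hb φ z hz.1 (hz.2.trans hρ)
    have hz0 : (0:ℝ) ≤ z := hz.1
    have e1 : |z * radialRateDeriv H β H' β' φ z| ≤ z * M := by
      rw [abs_mul, abs_of_nonneg hz0]; exact mul_le_mul_of_nonneg_left a2 hz0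
    simp only [id, one_mul]
    refine (norm_add_le _ _).trans ?_
    rw [Real.norm_eq_abs, Real.norm_eq_abs]
    have := mul_le_mul_of_nonneg_left hz.2 hM.le
    linarith
  · have a1 := (hb φ r hr.1 (hr.2.trans hρ)).2.2.1
    have := mul_le_mul_of_nonneg_left hr.2 hM.le
    have : 0 ≤ M * r := mul_nonneg hM.le hr.1
    linarith

/-- Two small closed orbits stay ordered, with almost constant distances. -/
theorem exists_orbit_comparison (h : LocalExpansion H β H' β' p₀ p₁ q₀) :
    ∃ M > 0, ∃ η > 0, ∀ ρ ≤ η, ∀ r s : ℝ → ℝ, IsPolarOrbit H β ρ r → IsPolarOrbit H β ρ s →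
      (∀ φ, |-(s φ * radialRate H β φ (s φ)) - -(r φ * radialRate H β φ (r φ))| ≤
        M * ρ * |s φ - r φ|) ∧ (∀ φ, |-(r φ * radialRate H β φ (r φ))| ≤ M * ρ * |r φ|) ∧
      (∀ φ, |H (r φ * Real.cos φ)| ≤ 1 / 2) := by
  obtain ⟨M, hM, η, hη, hb⟩ := h.exists_radial_lipschitz
  refine ⟨M, hM, η, hη, fun ρ hρ r s hr hs => ⟨fun φ => ?_, fun φ => ?_, fun φ => ?_⟩⟩
  · have := (hb ρ hρ φ (r φ) ⟨(hr φ).1.le, (hr φ).2.1⟩ (s φ) ⟨(hs φ).1.le, (hs φ).2.1⟩).1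
    rwa [neg_sub_neg, abs_sub_comm]
  · have h1 := (hb ρ hρ φ (r φ) ⟨(hr φ).1.le, (hr φ).2.1⟩ (r φ) ⟨(hr φ).1.le, (hr φ).2.1⟩).2.1
    rw [abs_neg, abs_mul, mul_comm]
    exact mul_le_mul_of_nonneg_right h1 (abs_nonneg _)
  · exact (hb ρ hρ φ (r φ) ⟨(hr φ).1.le, (hr φ).2.1⟩ (r φ) ⟨(hr φ).1.le, (hr φ).2.1⟩).2.2

/-- The difference of the squared radii of two ordered closed orbits is almost constant. -/
theorem exists_sq_sub_sq_close (h : LocalExpansion H β H' β' p₀ p₁ q₀) {ε : ℝ} (hε : 0 < ε) :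
    ∃ η > 0, ∀ r s : ℝ → ℝ, IsPolarOrbit H β η r → IsPolarOrbit H β η s → r 0 < s 0 →
      ∀ φ ∈ Icc 0 (2 * Real.pi), r φ < s φ ∧
        |s φ ^ 2 - r φ ^ 2 - (s 0 ^ 2 - r 0 ^ 2)| ≤ ε * (s 0 ^ 2 - r 0 ^ 2) := by
  obtain ⟨M, hM, η, hη, hb⟩ := h.exists_orbit_comparison
  -- One exponential is spent on s - r and one on s + r. The bound 1 + ε/(1 + ε) serves both
  -- directions: it is at most 1 + ε, and its inverse (1 + ε)/(1 + 2ε) is at least 1 - ε.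
  have hexp : ∀ᶠ ρ in 𝓝 (0:ℝ), Real.exp (M * ρ * (2 * Real.pi)) *
      Real.exp (M * ρ * (2 * Real.pi)) < 1 + ε / (1 + ε) := by
    have hc : Continuous fun ρ : ℝ => Real.exp (M * ρ * (2 * Real.pi)) *
      Real.exp (M * ρ * (2 * Real.pi)) := by fun_prop
    have h1 := hc.tendsto 0
    simp only [mul_zero, zero_mul, Real.exp_zero, mul_one] at h1
    exact h1.eventually_lt_const (by linarith [div_pos hε (by linarith : 0 < 1 + ε)])
  obtain ⟨ρ, ⟨hρ1, hρ2⟩, hρ0⟩ := ((hexp.and (eventually_le_nhds hη)).filter_mono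
    nhdsWithin_le_nhds |>.and (self_mem_nhdsWithin (s := Ioi 0))).exists
  refine ⟨ρ, hρ0, fun r s hr hs hrs φ hφ => ?_⟩
  obtain ⟨a1, a2, -⟩ := hb ρ hρ2 r s hr hs
  obtain ⟨-, a3, -⟩ := hb ρ hρ2 s r hs hr
  have hD : ∀ t, HasDerivAt (fun t => s t - r t) _ t := fun t => (hs t).2.2.1.sub (hr t).2.2.1
  have hlt : ∀ t, r t < s t := by
    intro t
    by_contra! hle
    have := nonpos_of_abs_deriv_le hD a1 (s := t) (by linarith) 0
    linarith
  have d1 := abs_le_exp_mul_abs_left hφ.1 (fun t _ => hD t) (fun t _ => a1 t)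
  have d2 := abs_le_exp_mul_abs_right hφ.1 (fun t _ => hD t) (fun t _ => a1 t)
  have d3 := abs_le_exp_mul_abs_left hφ.1 (fun t _ => (hr t).2.2.1) (fun t _ => a2 t)
  have d4 := abs_le_exp_mul_abs_right hφ.1 (fun t _ => (hr t).2.2.1) (fun t _ => a2 t)
  have d5 := abs_le_exp_mul_abs_left hφ.1 (fun t _ => (hs t).2.2.1) (fun t _ => a3 t)
  have d6 := abs_le_exp_mul_abs_right hφ.1 (fun t _ => (hs t).2.2.1) (fun t _ => a3 t)
  have hE : Real.exp (M * ρ * (φ - 0)) ≤ Real.exp (M * ρ * (2 * Real.pi)) :=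
    Real.exp_le_exp.2 (mul_le_mul_of_nonneg_left (by linarith [hφ.2]) (by positivity))
  set E := Real.exp (M * ρ * (2 * Real.pi)) with hEdef
  have hE0 : 0 < E := Real.exp_pos _
  have l0 := hlt 0
  have lφ := hlt φ
  have r0 := (hr 0).1
  have rφ := (hr φ).1
  rw [abs_of_pos (sub_pos.2 l0), abs_of_pos (sub_pos.2 lφ)] at d1 d2
  rw [abs_of_pos r0, abs_of_pos rφ] at d3 d4
  rw [abs_of_pos (hs 0).1, abs_of_pos (hs φ).1] at d5 d6
  have s0 := (hs 0).1
  have sφ := (hs φ).1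
  have b1 := d1.trans (mul_le_mul_of_nonneg_left hE (by linarith))
  have b2 := d2.trans (mul_le_mul_of_nonneg_left hE (by linarith))
  have b3 := d3.trans (mul_le_mul_of_nonneg_left hE (by linarith))
  have b4 := d4.trans (mul_le_mul_of_nonneg_left hE (by linarith))
  have b5 := d5.trans (mul_le_mul_of_nonneg_left hE (by linarith))
  have b6 := d6.trans (mul_le_mul_of_nonneg_left hE (by linarith))
  have u1 : s φ ^ 2 - r φ ^ 2 ≤ (s 0 ^ 2 - r 0 ^ 2) * (E * E) := by
    have := mul_le_mul b1 (add_le_add b5 b3) (by linarith) (mul_nonneg (by linarith) hE0.le)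
    nlinarith
  have u2 : s 0 ^ 2 - r 0 ^ 2 ≤ (s φ ^ 2 - r φ ^ 2) * (E * E) := by
    have := mul_le_mul b2 (add_le_add b6 b4) (by linarith) (mul_nonneg (by linarith) hE0.le)
    nlinarith
  have v0 : 0 < s 0 ^ 2 - r 0 ^ 2 := by nlinarith
  have vφ : 0 < s φ ^ 2 - r φ ^ 2 := by nlinarith
  have w1 : E * E * (1 + ε) < 1 + 2 * ε := by
    have : (1 + ε / (1 + ε)) * (1 + ε) = 1 + 2 * ε := by field_simp; ring
    rw [← this]
    exact mul_lt_mul_of_pos_right hρ1 (by linarith)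
  have w2 : ε / (1 + ε) ≤ ε := div_le_self hε.le (by linarith)
  refine ⟨lφ, abs_le.2 ⟨?_, ?_⟩⟩
  · have h1 := mul_le_mul_of_nonneg_right u2 (by linarith : 0 ≤ 1 + ε)
    have h2 := mul_le_mul_of_nonneg_left w1.le vφ.le
    have h3 : (s 0 ^ 2 - r 0 ^ 2) * ((1 - ε) * (1 + 2 * ε)) ≤ (s 0 ^ 2 - r 0 ^ 2) * (1 + ε) :=
      mul_le_mul_of_nonneg_left (by nlinarith) v0.le
    have h4 : (s 0 ^ 2 - r 0 ^ 2) * (1 - ε) * (1 + 2 * ε) ≤ (s φ ^ 2 - r φ ^ 2) * (1 + 2 * ε) := by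
      linarith
    have := le_of_mul_le_mul_right h4 (by linarith)
    linarith
  · have h1 := mul_le_mul_of_nonneg_left (hρ1.le.trans (add_le_add_right w2 1)) v0.le
    linarith

end LocalExpansion

/-! ### Differences of turn times -/

theorem continuous_periodDensity (p₀ p₁ q₀ : ℝ) : Continuous (periodDensity p₀ p₁ q₀) := by
  unfold periodDensity; fun_prop

/-- The q₀ term is the derivative of a polynomial in sin φ and drops out over a full turn. In the
antiderivative, 4/3 is 1 from cos⁶ plus 1/3 from integrating (sin - sin³/3) sin cos² by parts. -/
theorem integral_periodDensity (p₀ p₁ q₀ : ℝ) :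
    ∫ φ in (0:ℝ)..(2 * Real.pi), periodDensity p₀ p₁ q₀ φ =
      5 * Real.pi / 6 * p₀ ^ 2 - 3 * Real.pi / 4 * p₁ := by
  have key : ∀ φ : ℝ, HasDerivAt (fun φ => (4 / 3) * p₀ ^ 2 * (Real.cos φ ^ 5 * Real.sin φ / 6 +
      5 / 6 * (Real.cos φ ^ 3 * Real.sin φ / 4 + 3 / 4 * (Real.cos φ * Real.sin φ / 2 + φ / 2))) -
      p₁ * (Real.cos φ ^ 3 * Real.sin φ / 4 + 3 / 4 * (Real.cos φ * Real.sin φ / 2 + φ / 2)) -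
      p₀ ^ 2 * (Real.cos φ ^ 3 / 3 * (Real.sin φ - Real.sin φ ^ 3 / 3)) -
      p₀ * q₀ * (Real.sin φ ^ 2 / 2 - Real.sin φ ^ 4 / 12)) (periodDensity p₀ p₁ q₀ φ) φ := by
    intro φ
    have hs := Real.hasDerivAt_sin φ
    have hc := Real.hasDerivAt_cos φ
    have h4 := (((hc.pow 3).mul hs).div_const 4).add
      ((((hc.mul hs).div_const 2).add ((hasDerivAt_id φ).div_const 2)).const_mul (3 / 4))
    have h6 := (((hc.pow 5).mul hs).div_const 6).add (h4.const_mul (5 / 6))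
    have h := (((h6.const_mul ((4 / 3) * p₀ ^ 2)).sub (h4.const_mul p₁)).sub
      ((((hc.pow 3).div_const 3).mul (hs.sub ((hs.pow 3).div_const 3))).const_mul (p₀ ^ 2))).sub
      ((((hs.pow 2).div_const 2).sub ((hs.pow 4).div_const 12)).const_mul (p₀ * q₀))
    refine h.congr_deriv ?_
    have h1 := Real.sin_sq_add_cos_sq φ
    simp only [periodDensity, Pi.pow_apply, Pi.sub_apply, Nat.cast_ofNat]
    generalize Real.sin φ = s at *
    generalize Real.cos φ = c at *
    have h2 : s ^ 2 = 1 - c ^ 2 := by linarith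
    have h3 : s ^ 3 = s * (1 - c ^ 2) := by rw [← h2]; ring
    have h4 : s ^ 4 = (1 - c ^ 2) ^ 2 := by rw [← h2]; ring
    norm_num
    ring_nf
    simp only [h2, h3, h4]
    ring
  rw [intervalIntegral.integral_eq_sub_of_hasDerivAt (fun φ _ => key φ)
    ((continuous_periodDensity p₀ p₁ q₀).intervalIntegrable _ _)]
  simp
  ring

namespace LocalExpansion

variable {H β H' β' : ℝ → ℝ} {p₀ p₁ q₀ : ℝ}

/-- Mean value inequality on [r, s] for the function minus its quadratic part, with constant εs;
then s(s - r) ≤ s² - r². -/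
theorem exists_normalizedTimeRate_sub_close (h : LocalExpansion H β H' β' p₀ p₁ q₀) {ε : ℝ}
    (hε : 0 < ε) :
    ∃ η > 0, ∀ φ r s, 0 ≤ r → r ≤ s → s ≤ η →
      |normalizedTimeRate H β p₀ φ s - normalizedTimeRate H β p₀ φ r -
        periodDensity p₀ p₁ q₀ φ * (s ^ 2 - r ^ 2)| ≤ ε * (s ^ 2 - r ^ 2) := by
  obtain ⟨M, hM, η₁, hη₁, hb⟩ := h.exists_radial_bounds
  have h1 := h.isLittleO_normalizedTimeRateDeriv.bound hε
  obtain ⟨P, hP, Q, hQ, hPQ⟩ := Filter.eventually_prod_iff.1 h1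
  rw [eventually_top] at hP
  obtain ⟨η₂, hη₂, h2⟩ := Metric.eventually_nhds_iff.1 hQ
  refine ⟨min η₁ (η₂ / 2), lt_min hη₁ (by linarith), fun φ r s hr hrs hs => ?_⟩
  have hs1 := hs.trans (min_le_left _ _)
  have hs2 := hs.trans (min_le_right _ _)
  have h3 := (convex_Icc r s).norm_image_sub_le_of_norm_hasDerivWithin_le (C := ε * s)
    (f := fun z => normalizedTimeRate H β p₀ φ z - periodDensity p₀ p₁ q₀ φ * z ^ 2)
    (f' := fun z => normalizedTimeRateDeriv H β H' β' p₀ φ z - 2 * periodDensity p₀ p₁ q₀ φ * z)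
    (fun z hz => by
      have a1 := (hb φ z (hr.trans hz.1) (hz.2.trans hs1)).2.1
      have a2 := ((hasDerivAt_id z).pow 2).const_mul (periodDensity p₀ p₁ q₀ φ)
      refine ((a1.sub a2).congr_deriv ?_).hasDerivWithinAt
      simp only [Nat.cast_ofNat, id, mul_one]
      ring)
    (fun z hz => by
      have hz0 := hr.trans hz.1
      have a1 := hPQ (hP φ) (h2 (y := z) (by
        rw [Real.dist_eq, sub_zero, abs_of_nonneg hz0]; linarith [hz.2]))
      refine a1.trans (mul_le_mul_of_nonneg_left ?_ hε.le)
      rw [Real.norm_of_nonneg hz0]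
      exact hz.2) (left_mem_Icc.2 hrs) (right_mem_Icc.2 hrs)
  rw [Real.norm_eq_abs, Real.norm_eq_abs, abs_of_nonneg (by linarith : (0:ℝ) ≤ s - r)] at h3
  have h4 : ε * s * (s - r) ≤ ε * (s ^ 2 - r ^ 2) := by
    rw [mul_assoc]
    exact mul_le_mul_of_nonneg_left (by nlinarith) hε.le
  refine le_trans (le_of_eq ?_) (h3.trans h4)
  congr 1
  ring

end LocalExpansion

theorem exists_abs_periodDensity_le (p₀ p₁ q₀ : ℝ) :
    ∃ B > 0, ∀ φ ∈ Icc 0 (2 * Real.pi), |periodDensity p₀ p₁ q₀ φ| ≤ B := by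
  obtain ⟨B, hB⟩ := isCompact_Icc.exists_bound_of_continuousOn
    (continuous_periodDensity p₀ p₁ q₀).continuousOn (s := Icc 0 (2 * Real.pi))
  refine ⟨|B| + 1, by positivity, fun φ hφ => ?_⟩
  have := hB φ hφ
  rw [Real.norm_eq_abs] at this
  linarith [le_abs_self B]

/-- The time that a closed orbit needs for one turn. -/
noncomputable def turnTime (H r : ℝ → ℝ) : ℝ :=
  ∫ φ in (0:ℝ)..(2 * Real.pi), timeRate H φ (r φ)

/-- The added terms are the derivative of p₀(sin φ - sin³φ/3) r(φ) along the orbit; the boundary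
values vanish because sin does at 0 and 2π. -/
theorem turnTime_eq {H β r : ℝ → ℝ} {η : ℝ} (p₀ : ℝ) (hH : Continuous H) (hβ : Continuous β)
    (hr : IsPolarOrbit H β η r) (hb : ∀ φ, |H (r φ * Real.cos φ)| ≤ 1 / 2) :
    Continuous (fun φ => normalizedTimeRate H β p₀ φ (r φ)) ∧
    turnTime H r = 2 * Real.pi +
      ∫ φ in (0:ℝ)..(2 * Real.pi), normalizedTimeRate H β p₀ φ (r φ) := by
  have hrc : Continuous r := continuous_iff_continuousAt.2 fun φ => (hr φ).2.2.1.continuousAt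
  have h0 : ∀ φ, 1 + Real.cos φ ^ 2 * H (r φ * Real.cos φ) ≠ 0 := fun φ => by
    have := one_half_le_one_add (hb φ) φ
    linarith
  have c1 : Continuous fun φ => timeRate H φ (r φ) := by
    unfold timeRate
    exact continuous_const.div (by fun_prop) h0
  have c2 : Continuous fun φ => radialRate H β φ (r φ) := by
    unfold radialRate
    exact Continuous.div (by fun_prop) (by fun_prop) h0
  have c3 : Continuous (fun φ => normalizedTimeRate H β p₀ φ (r φ)) := by
    unfold normalizedTimeRate
    fun_prop
  refine ⟨c3, ?_⟩
  have hd : ∀ φ, HasDerivAt (fun φ => p₀ * (Real.sin φ - Real.sin φ ^ 3 / 3) * r φ)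
      (normalizedTimeRate H β p₀ φ (r φ) + 1 - timeRate H φ (r φ)) φ := by
    intro φ
    have hs := Real.hasDerivAt_sin φ
    have h1 := ((hs.sub ((hs.pow 3).div_const 3)).const_mul p₀).mul (hr φ).2.2.1
    refine h1.congr_deriv ?_
    have h2 : Real.cos φ ^ 3 = (1 - Real.sin φ ^ 2) * Real.cos φ := by
      rw [← Real.cos_sq']; ring
    simp only [normalizedTimeRate, h2, Pi.sub_apply, Pi.pow_apply]
    norm_num
    ring
  have h1 := intervalIntegral.integral_eq_sub_of_hasDerivAt (a := 0) (b := 2 * Real.pi)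
    (fun φ _ => hd φ) (((c3.add continuous_const).sub c1).intervalIntegrable _ _)
  have c4 : Continuous fun φ => normalizedTimeRate H β p₀ φ (r φ) + 1 := by fun_prop
  rw [intervalIntegral.integral_sub (c4.intervalIntegrable _ _)
    (c1.intervalIntegrable _ _), intervalIntegral.integral_add (c3.intervalIntegrable _ _)
    (continuous_const.intervalIntegrable _ _)] at h1
  simp at h1
  rw [turnTime]
  linarith

namespace LocalExpansion

variable {H β H' β' : ℝ → ℝ} {p₀ p₁ q₀ : ℝ}

/-- Under the integral, s(φ)² - r(φ)² is replaced by its value at φ = 0, after which only the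
integral of the density matters. -/
theorem exists_turnTime_sub_close (h : LocalExpansion H β H' β' p₀ p₁ q₀) (hH : Continuous H)
    (hβ : Continuous β) {ε : ℝ} (hε : 0 < ε) :
    ∃ η > 0, ∀ r s : ℝ → ℝ, IsPolarOrbit H β η r → IsPolarOrbit H β η s → r 0 < s 0 →
      |turnTime H s - turnTime H r -
        (5 * Real.pi / 6 * p₀ ^ 2 - 3 * Real.pi / 4 * p₁) * (s 0 ^ 2 - r 0 ^ 2)| ≤
      ε * (s 0 ^ 2 - r 0 ^ 2) := by
  obtain ⟨B, hB, hBb⟩ := exists_abs_periodDensity_le p₀ p₁ q₀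
  have hpi := Real.pi_pos
  -- 2e pays for the expansion of the time rate (using 1 + e ≤ 2), Be for freezing s² - r² at φ = 0,
  -- and 2π is the length of the interval.
  obtain ⟨e, he, he1, heε⟩ : ∃ e > 0, e ≤ 1 ∧ (2 + B) * e * (2 * Real.pi) ≤ ε := by
    refine ⟨min 1 (ε / ((2 + B) * (2 * Real.pi))), lt_min one_pos (by positivity),
      min_le_left _ _, ?_⟩
    have h1 := min_le_right 1 (ε / ((2 + B) * (2 * Real.pi)))
    rw [le_div_iff₀ (by positivity)] at h1
    linarith
  obtain ⟨η₁, hη₁, h1⟩ := h.exists_sq_sub_sq_close he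
  obtain ⟨η₂, hη₂, h2⟩ := h.exists_normalizedTimeRate_sub_close he
  obtain ⟨M, -, η₃, hη₃, h3⟩ := h.exists_orbit_comparison
  have hmono : ∀ {η η' : ℝ} {r : ℝ → ℝ}, η ≤ η' → IsPolarOrbit H β η r → IsPolarOrbit H β η' r :=
    fun hle hr φ => ⟨(hr φ).1, (hr φ).2.1.trans hle, (hr φ).2.2⟩
  refine ⟨min η₁ (min η₂ η₃), lt_min hη₁ (lt_min hη₂ hη₃), fun r s hr hs hrs => ?_⟩
  have m1 : min η₁ (min η₂ η₃) ≤ η₁ := min_le_left _ _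
  have m2 : min η₁ (min η₂ η₃) ≤ η₂ := (min_le_right _ _).trans (min_le_left _ _)
  have m3 : min η₁ (min η₂ η₃) ≤ η₃ := (min_le_right _ _).trans (min_le_right _ _)
  have hclose := h1 r s (hmono m1 hr) (hmono m1 hs) hrs
  obtain ⟨cr, Tr⟩ := turnTime_eq p₀ hH hβ hr (h3 _ m3 r s hr hs).2.2
  obtain ⟨cs, Ts⟩ := turnTime_eq p₀ hH hβ hs (h3 _ m3 s r hs hr).2.2
  have cM := continuous_periodDensity p₀ p₁ q₀
  have r0 := (hr 0).1
  have v0 : 0 < s 0 ^ 2 - r 0 ^ 2 := by nlinarith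
  have hI : turnTime H s - turnTime H r -
        (5 * Real.pi / 6 * p₀ ^ 2 - 3 * Real.pi / 4 * p₁) * (s 0 ^ 2 - r 0 ^ 2) =
      ∫ φ in (0:ℝ)..(2 * Real.pi), (normalizedTimeRate H β p₀ φ (s φ) -
        normalizedTimeRate H β p₀ φ (r φ) - periodDensity p₀ p₁ q₀ φ * (s 0 ^ 2 - r 0 ^ 2)) := by
    have c1 : Continuous fun φ => normalizedTimeRate H β p₀ φ (s φ) -
        normalizedTimeRate H β p₀ φ (r φ) := cs.sub cr
    have c2 : Continuous fun φ => periodDensity p₀ p₁ q₀ φ * (s 0 ^ 2 - r 0 ^ 2) :=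
      cM.mul continuous_const
    rw [intervalIntegral.integral_sub (c1.intervalIntegrable _ _)
      (c2.intervalIntegrable _ _), intervalIntegral.integral_sub
      (cs.intervalIntegrable _ _) (cr.intervalIntegrable _ _),
      intervalIntegral.integral_mul_const, integral_periodDensity, Tr, Ts]
    ring
  rw [hI, ← Real.norm_eq_abs]
  have hle := intervalIntegral.norm_integral_le_of_norm_le_const (a := (0:ℝ)) (b := 2 * Real.pi)
    (C := (2 + B) * e * (s 0 ^ 2 - r 0 ^ 2))
    (f := fun φ => normalizedTimeRate H β p₀ φ (s φ) -
        normalizedTimeRate H β p₀ φ (r φ) - periodDensity p₀ p₁ q₀ φ * (s 0 ^ 2 - r 0 ^ 2)) ?_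
  · rw [sub_zero, abs_of_pos (by positivity : 0 < 2 * Real.pi)] at hle
    refine hle.trans ?_
    have := mul_le_mul_of_nonneg_right heε v0.le
    linarith
  · intro φ hφ
    rw [uIoc_of_le (by positivity)] at hφ
    have hφ' : φ ∈ Icc 0 (2 * Real.pi) := ⟨hφ.1.le, hφ.2⟩
    obtain ⟨a1, a2⟩ := hclose φ hφ'
    have a3 := h2 φ (r φ) (s φ) (hr φ).1.le a1.le ((hs φ).2.1.trans m2)
    have a4 := hBb φ hφ'
    have a5 : |periodDensity p₀ p₁ q₀ φ * (s φ ^ 2 - r φ ^ 2 - (s 0 ^ 2 - r 0 ^ 2))| ≤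
        B * (e * (s 0 ^ 2 - r 0 ^ 2)) := by
      rw [abs_mul]; exact mul_le_mul a4 a2 (abs_nonneg _) hB.le
    have a6 : s φ ^ 2 - r φ ^ 2 ≤ (1 + e) * (s 0 ^ 2 - r 0 ^ 2) := by
      have := (abs_le.1 a2).2
      linarith
    have a7 : e * (s φ ^ 2 - r φ ^ 2) ≤ 2 * e * (s 0 ^ 2 - r 0 ^ 2) := by
      have := mul_le_mul_of_nonneg_left a6 he.le
      nlinarith [mul_nonneg (mul_nonneg he.le (sub_nonneg.2 he1)) v0.le]
    have a8 := abs_add_le (normalizedTimeRate H β p₀ φ (s φ) - normalizedTimeRate H β p₀ φ (r φ) -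
        periodDensity p₀ p₁ q₀ φ * (s φ ^ 2 - r φ ^ 2))
      (periodDensity p₀ p₁ q₀ φ * (s φ ^ 2 - r φ ^ 2 - (s 0 ^ 2 - r 0 ^ 2)))
    rw [Real.norm_eq_abs]
    refine le_trans (le_of_eq ?_) (a8.trans ?_)
    · congr 1
      ring
    · linarith

/-- For small closed orbits, the order of the radii is that of the maximal abscissas. -/
theorem exists_lt_of_abscissa_lt (h : LocalExpansion H β H' β' p₀ p₁ q₀) :
    ∃ η > 0, ∀ r s : ℝ → ℝ, IsPolarOrbit H β η r → IsPolarOrbit H β η s → ∀ x y : ℝ,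
      0 < x → x < y →
      r (Real.arctan (-β x)) * Real.cos (Real.arctan (-β x)) = x →
      s (Real.arctan (-β y)) * Real.cos (Real.arctan (-β y)) = y → r 0 < s 0 := by
  obtain ⟨C, hC, η₁, hη₁, hb⟩ := h.exists_bounds
  obtain ⟨M, hM, η₂, hη₂, hcmp⟩ := h.exists_orbit_comparison
  have hev : ∀ᶠ ρ in 𝓝 (0:ℝ), (M * ρ * ρ + ρ) * C < 1 := by
    have hc : Continuous fun ρ : ℝ => (M * ρ * ρ + ρ) * C := by fun_prop
    have h1 := hc.tendsto 0
    simp only [mul_zero, zero_mul, add_zero] at h1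
    exact h1.eventually_lt_const one_pos
  obtain ⟨η, ⟨⟨hη3, hη1⟩, hη2⟩, hη0⟩ := (((hev.and (eventually_le_nhds hη₁)).and
    (eventually_le_nhds hη₂)).filter_mono nhdsWithin_le_nhds |>.and
    (self_mem_nhdsWithin (s := Ioi 0))).exists
  have hη0' : 0 < η := hη0
  refine ⟨η, hη0, fun r s hr hs x y hx hxy hrx hsy => ?_⟩
  by_contra! hle
  obtain ⟨a1, -, -⟩ := hcmp η hη2 r s hr hs
  obtain ⟨-, a2, a3⟩ := hcmp η hη2 r s hr hs
  have hle' : ∀ t, s t ≤ r t := by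
    intro t
    have := nonpos_of_abs_deriv_le (D := fun t => s t - r t)
      (fun t => (hs t).2.2.1.sub (hr t).2.2.1) a1 (s := 0) (by linarith) t
    linarith
  have hrc : Continuous r := continuous_iff_continuousAt.2 fun φ => (hr φ).2.2.1.continuousAt
  have hpi := Real.pi_pos
  have harc : ∀ z : ℝ, Real.arctan z ∈ Icc (-(Real.pi / 2)) (Real.pi / 2) := fun z =>
    ⟨(Real.neg_pi_div_two_lt_arctan z).le, (Real.arctan_lt_pi_div_two z).le⟩
  -- With s ≤ r everywhere, the orbit r reaches an abscissa x' ≥ y > x in the right half plane. The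
  -- maximum will be a second crossing of r with the curve Y = Xβ(X), besides the one at x.
  obtain ⟨φ, hφ, hmax⟩ := isCompact_Icc.exists_isMaxOn
    (nonempty_Icc.2 (by linarith : -(Real.pi / 2) ≤ Real.pi / 2))
    (hrc.mul Real.continuous_cos).continuousOn
  have hyφ : y ≤ r φ * Real.cos φ := by
    have h1 := isMaxOn_iff.1 hmax _ (harc (-β y))
    refine le_trans (hsy.symm.le.trans ?_) h1
    exact mul_le_mul_of_nonneg_right (hle' _) (Real.cos_arctan_pos _).le
  have hcos : Real.cos φ ≠ 0 := fun h0 => by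
    rw [h0, mul_zero] at hyφ
    linarith
  have hφ' : φ ∈ Ioo (-(Real.pi / 2)) (Real.pi / 2) := by
    refine ⟨lt_of_le_of_ne hφ.1 fun h0 => hcos ?_, lt_of_le_of_ne hφ.2 fun h0 => hcos ?_⟩
    · rw [← h0, Real.cos_neg, Real.cos_pi_div_two]
    · rw [h0, Real.cos_pi_div_two]
  have hder : ∀ t, HasDerivAt (fun t => r t * Real.cos t)
      (-(r t * radialRate H β t (r t)) * Real.cos t + r t * -Real.sin t) t := fun t =>
    (hr t).2.2.1.mul (Real.hasDerivAt_cos t)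
  have hzero := (hmax.isLocalMax (Icc_mem_nhds hφ'.1 hφ'.2)).hasDerivAt_eq_zero (hder φ)
  -- Criticality of the abscissa means X' = 0, that is Y = Xβ(X).
  have htan : Real.sin φ = -β (r φ * Real.cos φ) * Real.cos φ := by
    have hden := one_half_le_one_add (a3 φ) φ
    have hr0 := (hr φ).1
    have h1 : r φ * (radialRate H β φ (r φ) * Real.cos φ + Real.sin φ) = 0 := by linarith
    rcases mul_eq_zero.1 h1 with h2 | h2
    · linarith
    · rw [radialRate] at h2
      have hden' : 1 + Real.cos φ ^ 2 * H (r φ * Real.cos φ) ≠ 0 := by linarith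
      rw [div_mul_eq_mul_div, div_add' _ _ _ hden', div_eq_zero_iff] at h2
      rcases h2 with h2 | h2
      · linarith
      · exact absurd h2 hden'
  set x' := r φ * Real.cos φ with hx'
  have hφx : φ = Real.arctan (-β x') := by
    rw [← Real.arctan_tan hφ'.1 hφ'.2, Real.tan_eq_sin_div_cos, htan]
    rw [mul_div_cancel_right₀ _ hcos]
  have hrφ : r (Real.arctan (-β x')) * Real.cos (Real.arctan (-β x')) = x' := by
    rw [← hφx]
  have hbound : ∀ t, ‖-(r t * radialRate H β t (r t)) * Real.cos t + r t * -Real.sin t‖ ≤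
      M * η * η + η := by
    intro t
    have hr0 := (hr t).1
    have b1 := a2 t
    rw [abs_of_pos hr0] at b1
    have b2 := (hr t).2.1
    have b3 : |(-(r t * radialRate H β t (r t)) * Real.cos t)| ≤ M * η * r t * 1 := by
      rw [abs_mul]
      exact mul_le_mul b1 (Real.abs_cos_le_one t) (abs_nonneg _) (by positivity)
    have b4 : |r t * -Real.sin t| ≤ r t * 1 := by
      rw [abs_mul, abs_neg, abs_of_pos hr0]
      exact mul_le_mul_of_nonneg_left (Real.abs_sin_le_one t) hr0.le
    have b5 := mul_le_mul_of_nonneg_left b2 (by positivity : 0 ≤ M * η)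
    refine (norm_add_le _ _).trans ?_
    rw [Real.norm_eq_abs, Real.norm_eq_abs]
    linarith
  -- Both crossings have angle arctan(-β(abscissa)), and the abscissa depends on the angle with
  -- constant Mη² + η. By `hη3` the composition is a contraction near the origin, so the two
  -- crossings coincide, a contradiction.
  have hlip := convex_univ.norm_image_sub_le_of_norm_hasDerivWithin_le
    (fun t _ => (hder t).hasDerivWithinAt) (fun t _ => hbound t)
    (mem_univ (Real.arctan (-β x))) (mem_univ (Real.arctan (-β x')))
  simp only [hrx, hrφ, Real.norm_eq_abs] at hlip
  have hx'η : x' ≤ η := (le_abs_self _).trans ((abs_mul_cos_le (hr φ).1.le φ).trans (hr φ).2.1)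
  have hβ := (convex_Icc 0 η).norm_image_sub_le_of_norm_hasDerivWithin_le (f := β) (f' := β')
    (C := C) (x := x) (y := x')
    (fun z hz => (hb z (by rw [abs_of_nonneg hz.1]; exact hz.2.trans hη1)).2.1.hasDerivWithinAt)
    (fun z hz => (hb z (by rw [abs_of_nonneg hz.1]; exact hz.2.trans hη1)).2.2.2.2.2.2)
    ⟨hx.le, by linarith⟩ ⟨by linarith, hx'η⟩
  rw [Real.norm_eq_abs, Real.norm_eq_abs] at hβ
  have harct := abs_arctan_sub_arctan_le (-β x') (-β x)
  rw [neg_sub_neg, abs_sub_comm (β x)] at harct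
  have hpos : 0 < |x' - x| := abs_pos.2 (by linarith)
  have c1 := mul_le_mul_of_nonneg_left (harct.trans hβ) (by positivity : 0 ≤ M * η * η + η)
  have c2 := mul_lt_mul_of_pos_right hη3 hpos
  linarith

end LocalExpansion

/-! ### Polar coordinates along a solution -/

/-- `(X, Y)` is a solution of `X' = Y - X β(X)`, `Y' = -X (1 + H(X)) - β(X) Y`. -/
def IsSystemCurve (H β X Y : ℝ → ℝ) : Prop :=
  ∀ t, HasDerivAt X (Y t - X t * β (X t)) t ∧
    HasDerivAt Y (-(X t) * (1 + H (X t)) - β (X t) * Y t) t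

/-- A function whose derivative is continuous and at least `1 / 2` is a diffeomorphism. -/
theorem exists_inverse_of_one_half_le_deriv {Φ m : ℝ → ℝ} (hΦ : ∀ t, HasDerivAt Φ (m t) t)
    (hm : ∀ t, 1 / 2 ≤ m t) :
    ∃ ψ : ℝ → ℝ, (∀ t, ψ (Φ t) = t) ∧ (∀ φ, Φ (ψ φ) = φ) ∧ StrictMono ψ ∧
      (∀ φ, HasDerivAt ψ (m (ψ φ))⁻¹ φ) ∧ ∀ φ, |ψ φ| ≤ 2 * |φ - Φ 0| := by
  have hmono : Monotone fun t => Φ t - t / 2 :=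
    monotone_of_hasDerivAt_nonneg (fun t => (hΦ t).sub ((hasDerivAt_id t).div_const 2))
      (fun t => by have := hm t; simp only [Pi.zero_apply]; linarith)
  have hs : StrictMono Φ := fun s t hst => by
    have := hmono hst.le
    simp only at this
    linarith
  have hc : Continuous Φ := continuous_iff_continuousAt.2 fun t => (hΦ t).continuousAt
  have htop : Tendsto Φ atTop atTop := by
    refine tendsto_atTop_mono' atTop ?_
      (tendsto_atTop_add_const_left atTop (Φ 0) (tendsto_id.atTop_div_const two_pos))
    filter_upwards [eventually_ge_atTop 0] with t ht
    have := hmono ht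
    simp only [id] at this ⊢
    linarith
  have hbot : Tendsto Φ atBot atBot := by
    refine tendsto_atBot_mono' atBot ?_
      (tendsto_atBot_add_const_left atBot (Φ 0) (tendsto_id.atBot_div_const two_pos))
    filter_upwards [eventually_le_atBot 0] with t ht
    have := hmono ht
    simp only [id] at this ⊢
    linarith
  let e := hs.orderIsoOfSurjective Φ (hc.surjective htop hbot)
  have he : ∀ t, e t = Φ t := fun t => rfl
  have h1 : ∀ φ, Φ (e.symm φ) = φ := fun φ => by rw [← he, e.apply_symm_apply]
  refine ⟨e.symm, fun t => by rw [← he, e.symm_apply_apply], h1, e.symm.strictMono, fun φ => ?_,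
    fun φ => ?_⟩
  · exact HasDerivAt.of_local_left_inverse e.symm.continuous.continuousAt (hΦ _)
      (by have := hm (e.symm φ); linarith) (Eventually.of_forall h1)
  · have h2 := h1 φ
    set t := e.symm φ
    rcases le_total 0 t with ht | ht
    · have := hmono ht
      simp only at this
      rw [abs_of_nonneg ht]
      linarith [le_abs_self (φ - Φ 0)]
    · have := hmono ht
      simp only at this
      rw [abs_of_nonpos ht]
      linarith [neg_abs_le (φ - Φ 0)]

theorem exists_polar_angle (x y : ℝ) :
    ∃ φ, x = √(x ^ 2 + y ^ 2) * Real.cos φ ∧ y = -(√(x ^ 2 + y ^ 2) * Real.sin φ) := by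
  -- The conjugate appears because Y = -r sin φ: the motion is clockwise, so φ increases with time.
  have h1 := Complex.norm_mul_cos_arg (⟨x, -y⟩ : ℂ)
  have h2 := Complex.norm_mul_sin_arg (⟨x, -y⟩ : ℂ)
  have h3 : ‖(⟨x, -y⟩ : ℂ)‖ = √(x ^ 2 + y ^ 2) := by
    rw [Complex.norm_def, Complex.normSq_mk]
    congr 1
    ring
  rw [h3] at h1 h2
  exact ⟨_, h1.symm, by simp only at h2; linarith⟩

namespace IsSystemCurve

variable {H β X Y : ℝ → ℝ}

theorem hasDerivAt_sq_add_sq (h : IsSystemCurve H β X Y) (t : ℝ) :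
    HasDerivAt (fun t => X t ^ 2 + Y t ^ 2)
      (-2 * β (X t) * (X t ^ 2 + Y t ^ 2) - 2 * X t * Y t * H (X t)) t := by
  have h1 := ((h t).1.pow 2).add ((h t).2.pow 2)
  refine h1.congr_deriv ?_
  norm_num
  ring

theorem continuous_X (h : IsSystemCurve H β X Y) : Continuous X :=
  continuous_iff_continuousAt.2 fun t => (h t).1.continuousAt

theorem continuous_Y (h : IsSystemCurve H β X Y) : Continuous Y :=
  continuous_iff_continuousAt.2 fun t => (h t).2.continuousAt

theorem abs_deriv_sq_add_sq_le {K : ℝ} (hH : ∀ x, |H x| ≤ K) (hβ : ∀ x, |β x| ≤ K) (t : ℝ) :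
    |-2 * β (X t) * (X t ^ 2 + Y t ^ 2) - 2 * X t * Y t * H (X t)| ≤
      3 * K * |X t ^ 2 + Y t ^ 2| := by
  have hN : 0 ≤ X t ^ 2 + Y t ^ 2 := by positivity
  rw [abs_of_nonneg hN]
  have h1 : |-2 * β (X t) * (X t ^ 2 + Y t ^ 2)| ≤ 2 * K * (X t ^ 2 + Y t ^ 2) := by
    rw [abs_mul, abs_mul, abs_of_nonneg hN, abs_neg, abs_two]
    exact mul_le_mul_of_nonneg_right (mul_le_mul_of_nonneg_left (hβ _) zero_le_two) hN
  have h2 : |2 * X t * Y t| ≤ X t ^ 2 + Y t ^ 2 := by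
    rw [abs_le]
    constructor <;> nlinarith [sq_nonneg (X t + Y t), sq_nonneg (X t - Y t)]
  have h3 : |2 * X t * Y t * H (X t)| ≤ (X t ^ 2 + Y t ^ 2) * K := by
    rw [abs_mul]
    exact mul_le_mul h2 (hH _) (abs_nonneg _) hN
  refine (abs_sub _ _).trans ?_
  linarith

/-- Uses global bounds on the coefficients, so that it applies before the solution is known to be
small. -/
theorem sq_add_sq_le {K : ℝ} (h : IsSystemCurve H β X Y) (hH : ∀ x, |H x| ≤ K)
    (hβ : ∀ x, |β x| ≤ K) (s t : ℝ) :
    X t ^ 2 + Y t ^ 2 ≤ (X s ^ 2 + Y s ^ 2) * Real.exp (3 * K * |t - s|) := by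
  rcases le_total s t with hst | hts
  · have h1 := abs_le_exp_mul_abs_left hst (fun t _ => h.hasDerivAt_sq_add_sq t)
      (fun t _ => abs_deriv_sq_add_sq_le hH hβ t)
    rwa [abs_of_nonneg (by positivity), abs_of_nonneg (by positivity),
      ← abs_of_nonneg (sub_nonneg.2 hst)] at h1
  · have h1 := abs_le_exp_mul_abs_right hts (fun t _ => h.hasDerivAt_sq_add_sq t)
      (fun t _ => abs_deriv_sq_add_sq_le hH hβ t)
    rwa [abs_of_nonneg (by positivity), abs_of_nonneg (by positivity),
      ← abs_of_nonneg (sub_nonneg.2 hts), abs_sub_comm] at h1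

/-- Polar coordinates along a solution, with the time as a function of the polar angle. The
formulas hold as long as the solution stays in the region where `|H| ≤ 1 / 2`. -/
theorem exists_polar (h : IsSystemCurve H β X Y) (hH : Continuous H)
    (hN : ∀ t, 0 < X t ^ 2 + Y t ^ 2) :
    ∃ Φ ψ : ℝ → ℝ, (∀ t, ψ (Φ t) = t) ∧ (∀ φ, Φ (ψ φ) = φ) ∧ StrictMono ψ ∧
      (∀ φ, |ψ φ| ≤ 2 * |φ - Φ 0|) ∧
      ∀ T : ℝ, (∀ t, |t| < T → |H (X t)| ≤ 1 / 2) → ∀ φ, |ψ φ| < T →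
        X (ψ φ) = √(X (ψ φ) ^ 2 + Y (ψ φ) ^ 2) * Real.cos φ ∧
        Y (ψ φ) = -(√(X (ψ φ) ^ 2 + Y (ψ φ) ^ 2) * Real.sin φ) ∧
        HasDerivAt ψ (timeRate H φ √(X (ψ φ) ^ 2 + Y (ψ φ) ^ 2)) φ ∧
        HasDerivAt (fun φ => √(X (ψ φ) ^ 2 + Y (ψ φ) ^ 2))
          (-(√(X (ψ φ) ^ 2 + Y (ψ φ) ^ 2) *
            radialRate H β φ √(X (ψ φ) ^ 2 + Y (ψ φ) ^ 2))) φ := by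
  obtain ⟨φ₀, hφx, hφy⟩ := exists_polar_angle (X 0) (Y 0)
  have hX := h.continuous_X
  have hY := h.continuous_Y
  -- The angular speed, truncated from below at 1/2 so that Φ is a diffeomorphism of the line in any
  -- case. Where |H| ≤ 1/2 the truncation has no effect.
  set m : ℝ → ℝ := fun t => max (1 + X t ^ 2 * H (X t) / (X t ^ 2 + Y t ^ 2)) (1 / 2) with hm
  have hmc : Continuous m := by
    refine Continuous.max (continuous_const.add (Continuous.div (by fun_prop) (by fun_prop)
      fun t => (hN t).ne')) continuous_const
  set Φ : ℝ → ℝ := fun t => φ₀ + ∫ s in (0:ℝ)..t, m s with hΦdef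
  have hΦ : ∀ t, HasDerivAt Φ (m t) t := fun t =>
    (intervalIntegral.integral_hasDerivAt_right (hmc.intervalIntegrable _ _)
      (hmc.stronglyMeasurableAtFilter _ _) hmc.continuousAt).const_add φ₀
  have hΦ0 : Φ 0 = φ₀ := by simp [hΦdef]
  obtain ⟨ψ, h1, h2, h3, h4, h5⟩ := exists_inverse_of_one_half_le_deriv hΦ
    (fun t => le_max_right _ _)
  refine ⟨Φ, ψ, h1, h2, h3, h5, fun T hT => ?_⟩
  have hmT : ∀ t, |t| < T → m t = 1 + X t ^ 2 * H (X t) / (X t ^ 2 + Y t ^ 2) := by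
    intro t ht
    refine max_eq_left ?_
    have a1 := hN t
    have a2 := abs_le.1 (hT t ht)
    have a3 : -(1 / 2) ≤ X t ^ 2 * H (X t) / (X t ^ 2 + Y t ^ 2) := by
      rw [le_div_iff₀ a1]
      nlinarith [sq_nonneg (X t), sq_nonneg (Y t)]
    linarith
  have hρ : ∀ t, 0 < √(X t ^ 2 + Y t ^ 2) := fun t => Real.sqrt_pos.2 (hN t)
  have hρ2 : ∀ t, √(X t ^ 2 + Y t ^ 2) ^ 2 = X t ^ 2 + Y t ^ 2 := fun t => Real.sq_sqrt (hN t).le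
  have hρd : ∀ t, HasDerivAt (fun t => √(X t ^ 2 + Y t ^ 2))
      ((-2 * β (X t) * (X t ^ 2 + Y t ^ 2) - 2 * X t * Y t * H (X t)) /
        (2 * √(X t ^ 2 + Y t ^ 2))) t := fun t =>
    (h.hasDerivAt_sq_add_sq t).sqrt (hN t).ne'
  have hmN : ∀ t, |t| < T → m t * √(X t ^ 2 + Y t ^ 2) ^ 2 =
      X t ^ 2 * (1 + H (X t)) + Y t ^ 2 := by
    intro t ht
    rw [hmT t ht, hρ2]
    have := (hN t).ne'
    field_simp
    ring
  -- `hA` and `hB` say that the unit vector of (X, Y), rotated back by the angle Φ, is constant; at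
  -- t = 0 it is (1, 0).
  have hA : ∀ t, |t| < T → HasDerivAt (fun t => (X t * Real.cos (Φ t) - Y t * Real.sin (Φ t)) /
      √(X t ^ 2 + Y t ^ 2)) 0 t := by
    intro t ht
    have a1 := (((h t).1.mul (hΦ t).cos).sub ((h t).2.mul (hΦ t).sin)).div (hρd t) (hρ t).ne'
    refine a1.congr_deriv ?_
    have a2 := hmN t ht
    have a3 := hρ2 t
    have a4 := (hρ t).ne'
    simp only [Pi.mul_apply, Pi.sub_apply]
    generalize √(X t ^ 2 + Y t ^ 2) = ρ at *
    rw [← a3]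
    field_simp
    linear_combination (-(X t * Real.sin (Φ t) + Y t * Real.cos (Φ t))) * a2 +
      (Y t * Real.cos (Φ t) + X t * Real.sin (Φ t) * (1 + H (X t))) * a3
  have hB : ∀ t, |t| < T → HasDerivAt (fun t => (X t * Real.sin (Φ t) + Y t * Real.cos (Φ t)) /
      √(X t ^ 2 + Y t ^ 2)) 0 t := by
    intro t ht
    have a1 := (((h t).1.mul (hΦ t).sin).add ((h t).2.mul (hΦ t).cos)).div (hρd t) (hρ t).ne'
    refine a1.congr_deriv ?_
    have a2 := hmN t ht
    have a3 := hρ2 t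
    have a4 := (hρ t).ne'
    simp only [Pi.mul_apply, Pi.add_apply]
    generalize √(X t ^ 2 + Y t ^ 2) = ρ at *
    rw [← a3]
    field_simp
    linear_combination (X t * Real.cos (Φ t) - Y t * Real.sin (Φ t)) * a2 +
      (Y t * Real.sin (Φ t) - X t * Real.cos (Φ t) * (1 + H (X t))) * a3
  have hconst : ∀ F : ℝ → ℝ, (∀ t, |t| < T → HasDerivAt F 0 t) → ∀ t, |t| < T → F t = F 0 := by
    intro F hF t ht
    have a0 : (0:ℝ) ∈ Ioo (-T) T := abs_lt.1 (by rw [abs_zero]; exact (abs_nonneg t).trans_lt ht)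
    have a1 := (convex_Ioo (-T) T).norm_image_sub_le_of_norm_hasDerivWithin_le (C := 0)
      (fun s hs => (hF s (abs_lt.2 hs)).hasDerivWithinAt) (fun s _ => by simp) a0 (abs_lt.1 ht)
    rw [zero_mul] at a1
    exact sub_eq_zero.1 (norm_le_zero_iff.1 a1)
  have hpolar : ∀ t, |t| < T → X t = √(X t ^ 2 + Y t ^ 2) * Real.cos (Φ t) ∧
      Y t = -(√(X t ^ 2 + Y t ^ 2) * Real.sin (Φ t)) := by
    intro t ht
    have a1 := hconst _ hA t ht
    have a2 := hconst _ hB t ht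
    rw [hΦ0] at a1 a2
    have c1 := hρ t
    have c0 := hρ 0
    have e1 : X 0 * Real.cos φ₀ - Y 0 * Real.sin φ₀ = √(X 0 ^ 2 + Y 0 ^ 2) := by
      have := Real.sin_sq_add_cos_sq φ₀
      generalize √(X 0 ^ 2 + Y 0 ^ 2) = ρ at *
      rw [hφx, hφy]
      linear_combination ρ * this
    have e2 : X 0 * Real.sin φ₀ + Y 0 * Real.cos φ₀ = 0 := by
      generalize √(X 0 ^ 2 + Y 0 ^ 2) = ρ at *
      rw [hφx, hφy]
      ring
    rw [e1, div_self c0.ne', div_eq_one_iff_eq c1.ne'] at a1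
    rw [e2, zero_div, div_eq_zero_iff, or_iff_left c1.ne'] at a2
    have e3 := Real.sin_sq_add_cos_sq (Φ t)
    rw [← a1]
    constructor
    · linear_combination (-X t) * e3 + Real.sin (Φ t) * a2
    · linear_combination (-Y t) * e3 + Real.cos (Φ t) * a2
  intro φ hφ
  obtain ⟨b1, b2⟩ := hpolar _ hφ
  have b3 := hmN _ hφ
  have b0 := h4 φ
  have bd := (hρd (ψ φ)).comp φ b0
  have b4 := hρ (ψ φ)
  have b5 := hρ2 (ψ φ)
  have b6 : 1 / 2 ≤ m (ψ φ) := le_max_right _ _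
  rw [h2] at b1 b2
  have b7 : m (ψ φ) = 1 + Real.cos φ ^ 2 * H (√(X (ψ φ) ^ 2 + Y (ψ φ) ^ 2) * Real.cos φ) := by
    rw [← b1]
    have b8 : X (ψ φ) ^ 2 = √(X (ψ φ) ^ 2 + Y (ψ φ) ^ 2) ^ 2 * Real.cos φ ^ 2 := by
      conv_lhs => rw [b1]
      ring
    refine mul_right_cancel₀ (pow_ne_zero 2 b4.ne') (b3.trans ?_)
    linear_combination H (X (ψ φ)) * b8 - b5
  refine ⟨b1, b2, ?_, ?_⟩
  · rw [timeRate, one_div, ← b7]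
    exact b0
  · refine bd.congr_deriv ?_
    rw [radialRate, ← b7, ← b1]
    have b9 : X (ψ φ) * Y (ψ φ) = -(√(X (ψ φ) ^ 2 + Y (ψ φ) ^ 2) ^ 2 *
        (Real.cos φ * Real.sin φ)) := by
      refine (congrArg₂ (· * ·) b1 b2).trans ?_
      ring
    have b10 : m (ψ φ) ≠ 0 := by linarith
    rw [mul_assoc 2 (X (ψ φ)), b9]
    generalize H (X (ψ φ)) = u at *
    generalize β (X (ψ φ)) = w at *
    generalize √(X (ψ φ) ^ 2 + Y (ψ φ) ^ 2) = ρ at *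
    rw [← b5]
    field_simp
    ring

end IsSystemCurve

/-! ### Solutions near the center close up -/

theorem radialRate_add_two_pi (H β : ℝ → ℝ) (φ r : ℝ) :
    radialRate H β (φ + 2 * Real.pi) r = radialRate H β φ r := by
  simp [radialRate]

theorem timeRate_add_two_pi (H : ℝ → ℝ) (φ r : ℝ) :
    timeRate H (φ + 2 * Real.pi) r = timeRate H φ r := by
  simp [timeRate]

theorem abs_le_sqrt_sq_add_sq (x y : ℝ) : |x| ≤ √(x ^ 2 + y ^ 2) :=
  Real.abs_le_sqrt (by nlinarith [sq_nonneg y])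

namespace LocalExpansion

variable {H β H' β' : ℝ → ℝ} {p₀ p₁ q₀ : ℝ}

/-- A solution that starts at its point of minimal radius and stays small for a while closes up
after one turn. -/
theorem exists_closing (h : LocalExpansion H β H' β' p₀ p₁ q₀) (hH : Continuous H) :
    ∃ η > 0, ∀ X Y : ℝ → ℝ, IsSystemCurve H β X Y → (∀ t, 0 < X t ^ 2 + Y t ^ 2) →
      (∀ t, X 0 ^ 2 + Y 0 ^ 2 ≤ X t ^ 2 + Y t ^ 2) →
      (∀ t, |t| < 20 → √(X t ^ 2 + Y t ^ 2) ≤ η) →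
      ∃ T, 0 < T ∧ T < 20 ∧ X T = X 0 ∧ Y T = Y 0 := by
  obtain ⟨M, hM, η₁, hη₁, hlip⟩ := h.exists_radial_lipschitz
  obtain ⟨C, hC, η₂, hη₂, hb⟩ := h.exists_bounds
  refine ⟨min η₁ η₂, lt_min hη₁ hη₂, fun X Y hXY hN hmin hsmall => ?_⟩
  obtain ⟨Φ, ψ, h1, h2, hψ, h5, hpol⟩ := hXY.exists_polar hH hN
  replace hpol := hpol 20 fun t ht => (hb (X t)
    ((abs_le_sqrt_sq_add_sq _ _).trans ((hsmall t ht).trans (min_le_right _ _)))).2.2.1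
  have hψ0 : ψ (Φ 0) = 0 := h1 0
  generalize Φ 0 = φ₀ at h5 hψ0
  have hpi := Real.pi_pos
  have hpi4 : Real.pi < 3.15 := Real.pi_lt_d2
  -- The angular speed is at least 1/2, so a turn in either direction takes at most 4π < 20.
  have hrange : ∀ φ, |φ - φ₀| ≤ 2 * Real.pi → |ψ φ| < 20 := fun φ hφ => by
    have := h5 φ
    linarith
  set r : ℝ → ℝ := fun φ => √(X (ψ φ) ^ 2 + Y (ψ φ) ^ 2) with hr
  have hrle : ∀ φ, r φ₀ ≤ r φ := fun φ => by
    refine Real.sqrt_le_sqrt ?_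
    rw [hψ0]
    exact hmin _
  have hr0 : ∀ φ, 0 ≤ r φ := fun φ => Real.sqrt_nonneg _
  have hD : ∀ φ ∈ Icc φ₀ (φ₀ + 2 * Real.pi), HasDerivAt (fun φ => r φ - r (φ - 2 * Real.pi))
      (-(r φ * radialRate H β φ (r φ)) -
        -(r (φ - 2 * Real.pi) * radialRate H β (φ - 2 * Real.pi) (r (φ - 2 * Real.pi)))) φ := by
    intro φ hφ
    have a1 := (hpol φ (hrange φ (by rw [abs_of_nonneg] <;> linarith [hφ.1, hφ.2]))).2.2.2
    have a2 := (hpol (φ - 2 * Real.pi)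
      (hrange _ (by rw [abs_of_nonpos] <;> linarith [hφ.1, hφ.2]))).2.2.2
    have a3 := HasDerivAt.comp φ a2 ((hasDerivAt_id φ).sub_const (2 * Real.pi))
    exact (a1.sub a3).congr_deriv (by simp [hr])
  have hle : ∀ φ ∈ Icc φ₀ (φ₀ + 2 * Real.pi), |(-(r φ * radialRate H β φ (r φ)) -
        -(r (φ - 2 * Real.pi) * radialRate H β (φ - 2 * Real.pi) (r (φ - 2 * Real.pi))))| ≤
        M * min η₁ η₂ * |r φ - r (φ - 2 * Real.pi)| := by
    intro φ hφ
    have a1 := hsmall _ (hrange φ (by rw [abs_of_nonneg] <;> linarith [hφ.1, hφ.2]))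
    have a2 := hsmall _ (hrange (φ - 2 * Real.pi)
      (by rw [abs_of_nonpos] <;> linarith [hφ.1, hφ.2]))
    have a3 := radialRate_add_two_pi H β (φ - 2 * Real.pi) (r (φ - 2 * Real.pi))
    rw [sub_add_cancel] at a3
    rw [← a3, neg_sub_neg, abs_sub_comm]
    exact (hlip _ (min_le_left _ _) φ _ ⟨hr0 _, a2⟩ _ ⟨hr0 _, a1⟩).1
  have hπ : φ₀ ≤ φ₀ + 2 * Real.pi := by linarith
  -- Minimality of the radius at φ₀ is compared with the radius one turn earlier and one turn later,
  -- which gives opposite signs at the two ends.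
  have z0 := eq_zero_of_nonpos_of_nonneg hπ hD hle (by linarith [hrle (φ₀ - 2 * Real.pi)])
    (by rw [add_sub_cancel_right]; linarith [hrle (φ₀ + 2 * Real.pi)])
  have z1 := abs_le_exp_mul_abs_left hπ hD hle
  rw [z0, abs_zero, zero_mul, add_sub_cancel_right] at z1
  have z2 : r (φ₀ + 2 * Real.pi) = r φ₀ := sub_eq_zero.1 (abs_eq_zero.1 (le_antisymm z1 (abs_nonneg _)))
  have b0 := hrange (φ₀ + 2 * Real.pi) (by rw [add_sub_cancel_left, abs_of_pos (by linarith)])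
  obtain ⟨b1, b2, -⟩ := hpol _ b0
  obtain ⟨b3, b4, -⟩ := hpol φ₀ (hrange _ (by simp [hpi.le]))
  simp only [hr] at z2
  refine ⟨ψ (φ₀ + 2 * Real.pi), ?_, (le_abs_self _).trans_lt b0, ?_, ?_⟩
  · have := hψ (by linarith : φ₀ < φ₀ + 2 * Real.pi)
    rwa [hψ0] at this
  · rw [b1, z2, Real.cos_add_two_pi, ← b3, hψ0]
  · rw [b2, z2, Real.sin_add_two_pi, ← b4, hψ0]

/-- A small solution, starting at its point of minimal radius, is a closed orbit whose minimal
period is the time of one turn. -/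
theorem exists_isPolarOrbit (h : LocalExpansion H β H' β' p₀ p₁ q₀) (hH : Continuous H) :
    ∃ η₀ > 0, ∀ η ≤ η₀, ∀ X Y : ℝ → ℝ, IsSystemCurve H β X Y → (∀ t, 0 < X t ^ 2 + Y t ^ 2) →
      (∀ t, X 0 ^ 2 + Y 0 ^ 2 ≤ X t ^ 2 + Y t ^ 2) → (∀ t, √(X t ^ 2 + Y t ^ 2) ≤ η) →
      ∃ r, IsPolarOrbit H β η r ∧ 0 < turnTime H r ∧
        Function.Periodic X (turnTime H r) ∧ Function.Periodic Y (turnTime H r) ∧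
        (∀ τ, 0 < τ → X τ = X 0 → Y τ = Y 0 → turnTime H r ≤ τ) ∧
        ∀ t, 0 < X t → Y t = X t * β (X t) →
          r (Real.arctan (-β (X t))) * Real.cos (Real.arctan (-β (X t))) = X t := by
  obtain ⟨M, hM, η₁, hη₁, hlip⟩ := h.exists_radial_lipschitz
  obtain ⟨C, hC, η₂, hη₂, hb⟩ := h.exists_bounds
  refine ⟨min η₁ η₂, lt_min hη₁ hη₂, fun η hη X Y hXY hN hmin hsmall => ?_⟩
  obtain ⟨Φ, ψ, h1, h2, hψ, h5, hpol⟩ := hXY.exists_polar hH hN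
  -- The solution is small for all times, so any time bound beyond |ψ φ| will do.
  replace hpol := fun φ => hpol (|ψ φ| + 1) (fun t ht => (hb (X t)
    ((abs_le_sqrt_sq_add_sq _ _).trans ((hsmall t).trans (hη.trans (min_le_right _ _))))).2.2.1)
    φ (by linarith)
  have hψ0 : ψ (Φ 0) = 0 := h1 0
  have hpi := Real.pi_pos
  set r : ℝ → ℝ := fun φ => √(X (ψ φ) ^ 2 + Y (ψ φ) ^ 2) with hr
  have hr0 : ∀ φ, 0 < r φ := fun φ => Real.sqrt_pos.2 (hN _)
  have hrη : ∀ φ, r φ ≤ η := fun φ => hsmall _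
  have hrle : ∀ φ, r (Φ 0) ≤ r φ := fun φ => by
    refine Real.sqrt_le_sqrt ?_
    rw [hψ0]
    exact hmin _
  have hrd : ∀ φ, HasDerivAt r (-(r φ * radialRate H β φ (r φ))) φ := fun φ => (hpol φ).2.2.2
  have hrd2 : ∀ φ, HasDerivAt (fun φ => r (φ + 2 * Real.pi))
      (-(r (φ + 2 * Real.pi) * radialRate H β φ (r (φ + 2 * Real.pi)))) φ := fun φ => by
    have a3 := HasDerivAt.comp φ (hrd (φ + 2 * Real.pi))
      ((hasDerivAt_id φ).add_const (2 * Real.pi))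
    exact a3.congr_deriv (by rw [radialRate_add_two_pi, mul_one])
  have hle : ∀ F G : ℝ → ℝ, (∀ φ, F φ ∈ Icc 0 η) → (∀ φ, G φ ∈ Icc 0 η) → ∀ φ,
      |-(F φ * radialRate H β φ (F φ)) - -(G φ * radialRate H β φ (G φ))| ≤
        M * η * |F φ - G φ| := fun F G hF hG φ => by
    rw [neg_sub_neg, abs_sub_comm]
    exact (hlip η (hη.trans (min_le_left _ _)) φ _ (hG φ) _ (hF φ)).1
  have hrmem : ∀ φ, r φ ∈ Icc 0 η := fun φ => ⟨(hr0 φ).le, hrη φ⟩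
  -- The radius is minimal at Φ 0, so r(φ + 2π) - r(φ) is ≤ 0 at Φ 0 - 2π and ≥ 0 at Φ 0; each sign
  -- propagates to all angles.
  have hper : ∀ φ, r (φ + 2 * Real.pi) = r φ := by
    intro φ
    have a1 := nonpos_of_abs_deriv_le (D := fun φ => r (φ + 2 * Real.pi) - r φ)
      (s := Φ 0 - 2 * Real.pi) (fun t => (hrd2 t).sub (hrd t))
      (hle (fun φ => r (φ + 2 * Real.pi)) r (fun φ => hrmem _) hrmem)
      (by rw [sub_add_cancel]; linarith [hrle (Φ 0 - 2 * Real.pi)]) φ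
    have a2 := nonpos_of_abs_deriv_le (D := fun φ => r φ - r (φ + 2 * Real.pi))
      (s := Φ 0) (fun t => (hrd t).sub (hrd2 t))
      (hle r (fun φ => r (φ + 2 * Real.pi)) hrmem (fun φ => hrmem _))
      (by linarith [hrle (Φ 0 + 2 * Real.pi)]) φ
    linarith
  have hrper : Function.Periodic r (2 * Real.pi) := hper
  have hrc : Continuous r := continuous_iff_continuousAt.2 fun φ => (hrd φ).continuousAt
  have hψd : ∀ φ, HasDerivAt ψ (timeRate H φ (r φ)) φ := fun φ => (hpol φ).2.2.1
  have htc : Continuous fun φ => timeRate H φ (r φ) := by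
    unfold timeRate
    refine continuous_const.div (by fun_prop) fun φ => ?_
    have a1 := (hb (r φ * Real.cos φ) ((abs_mul_cos_le (hr0 φ).le φ).trans
      ((hrη φ).trans (hη.trans (min_le_right _ _))))).2.2.1
    have := one_half_le_one_add a1 φ
    linarith
  have hturn : turnTime H r = ψ (2 * Real.pi) - ψ 0 :=
    intervalIntegral.integral_eq_sub_of_hasDerivAt (fun φ _ => hψd φ) (htc.intervalIntegrable _ _)
  have hψper : ∀ φ, ψ (φ + 2 * Real.pi) = ψ φ + turnTime H r := by
    have hd : ∀ φ, HasDerivAt (fun φ => ψ (φ + 2 * Real.pi) - ψ φ) 0 φ := fun φ => by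
      have a3 := HasDerivAt.comp φ (hψd (φ + 2 * Real.pi))
        ((hasDerivAt_id φ).add_const (2 * Real.pi))
      exact (a3.sub (hψd φ)).congr_deriv (by rw [timeRate_add_two_pi, hper]; simp)
    intro φ
    have := is_const_of_deriv_eq_zero (fun φ => (hd φ).differentiableAt) (fun φ => (hd φ).deriv) φ 0
    simp only [zero_add] at this
    rw [hturn]
    linarith
  have hXper : ∀ t, X (t + turnTime H r) = X t ∧ Y (t + turnTime H r) = Y t := by
    intro t
    obtain ⟨b1, b2, -⟩ := hpol (Φ t + 2 * Real.pi)
    obtain ⟨b3, b4, -⟩ := hpol (Φ t)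
    have e := hper (Φ t)
    simp only [hr] at e
    rw [e, Real.cos_add_two_pi, ← b3, hψper, h1] at b1
    rw [e, Real.sin_add_two_pi, ← b4, hψper, h1] at b2
    exact ⟨b1, b2⟩
  refine ⟨r, fun φ => ⟨hr0 φ, hrη φ, hrd φ, hper φ⟩, ?_, fun t => (hXper t).1,
    fun t => (hXper t).2, fun τ hτ hXτ hYτ => ?_, fun t ht hYt => ?_⟩
  · rw [hturn]
    exact sub_pos.2 (hψ (by linarith))
  · obtain ⟨b1, b2, -⟩ := hpol (Φ τ)
    obtain ⟨b3, b4, -⟩ := hpol (Φ 0)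
    rw [h1, hXτ, hYτ] at b1 b2
    rw [hψ0] at b3 b4
    have hρ : √(X 0 ^ 2 + Y 0 ^ 2) ≠ 0 := (Real.sqrt_pos.2 (hN 0)).ne'
    have e1 : Real.cos (Φ τ) = Real.cos (Φ 0) := mul_left_cancel₀ hρ (b1.symm.trans b3)
    have e2 : Real.sin (Φ τ) = Real.sin (Φ 0) :=
      mul_left_cancel₀ hρ (neg_injective (b2.symm.trans b4))
    -- A return to the initial point advances the angle by 2πk; as the angle increases with time, k
    -- ≥ 1.
    obtain ⟨k, hk⟩ := Real.Angle.angle_eq_iff_two_pi_dvd_sub.1 (Real.Angle.cos_sin_inj e1 e2)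
    have hlt : Φ 0 < Φ τ := by
      by_contra! hle
      have := hψ.monotone hle
      rw [h1, h1] at this
      linarith
    have hk0 : 1 ≤ k := by
      by_contra! hk1
      have hk2 : (k : ℝ) ≤ 0 := by exact_mod_cast Int.lt_add_one_iff.1 hk1
      have := mul_nonpos_of_nonneg_of_nonpos (by positivity : 0 ≤ 2 * Real.pi) hk2
      linarith
    have hk1 : (1 : ℝ) ≤ k := by exact_mod_cast hk0
    have hge : Φ 0 + 2 * Real.pi ≤ Φ τ := by
      have := mul_le_mul_of_nonneg_left hk1 (by positivity : 0 ≤ 2 * Real.pi)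
      linarith
    have := hψ.monotone hge
    rwa [hψper, h1, h1, zero_add] at this
  · obtain ⟨n, hn, -⟩ := existsUnique_sub_zsmul_mem_Ioc (by positivity : 0 < 2 * Real.pi) (Φ t)
      (-Real.pi)
    rw [zsmul_eq_mul] at hn
    obtain ⟨b1, b2, -⟩ := hpol (Φ t)
    rw [show √(X (ψ (Φ t)) ^ 2 + Y (ψ (Φ t)) ^ 2) = r (Φ t) from rfl, h1] at b1 b2
    have e1 := hrper.sub_zsmul_eq n (x := Φ t)
    have e2 := Real.cos_periodic.sub_zsmul_eq n (x := Φ t)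
    have e3 := Real.sin_periodic.sub_zsmul_eq n (x := Φ t)
    rw [zsmul_eq_mul] at e1 e2 e3
    generalize Φ t - n * (2 * Real.pi) = φ at *
    rw [← e1, ← e2] at b1
    rw [← e1, ← e3] at b2
    have hcos : 0 < Real.cos φ := by
      by_contra! hc
      have := mul_nonpos_of_nonneg_of_nonpos (hr0 φ).le hc
      linarith
    have hφ1 : φ < Real.pi / 2 := by
      by_contra! hc
      have := Real.cos_nonpos_of_pi_div_two_le_of_le hc (by linarith [hn.2])
      linarith
    have hφ2 : -(Real.pi / 2) < φ := by
      by_contra! hc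
      have := Real.cos_nonpos_of_pi_div_two_le_of_le (x := -φ) (by linarith) (by linarith [hn.1])
      rw [Real.cos_neg] at this
      linarith
    have hφ : Real.arctan (-β (X t)) = φ := by
      rw [← Real.arctan_tan hφ2 hφ1, Real.tan_eq_sin_div_cos]
      congr 1
      rw [eq_div_iff hcos.ne']
      have e4 : r φ * (-β (X t) * Real.cos φ - Real.sin φ) = 0 := by
        linear_combination hYt - b2 + β (X t) * b1
      rcases mul_eq_zero.1 e4 with e5 | e5
      · exact absurd e5 (hr0 φ).ne'
      · linarith
    rw [hφ, ← b1]

/-- Periodic solutions through points near the origin are small closed orbits, provided that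
returning to the minimal radius point implies periodicity. -/
theorem exists_small_orbit (h : LocalExpansion H β H' β' p₀ p₁ q₀) (hH : Continuous H)
    {K : ℝ} (hHK : ∀ x, |H x| ≤ K) (hβK : ∀ x, |β x| ≤ K) {η : ℝ}
    (hη : 0 < η) :
    ∃ δ > 0, ∀ X Y : ℝ → ℝ, IsSystemCurve H β X Y → (∀ t, 0 < X t ^ 2 + Y t ^ 2) →
      (∀ t, X 0 ^ 2 + Y 0 ^ 2 ≤ X t ^ 2 + Y t ^ 2) → X 0 ^ 2 + Y 0 ^ 2 ≤ δ →
      (∀ T, 0 < T → X T = X 0 → Y T = Y 0 → Function.Periodic X T ∧ Function.Periodic Y T) →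
      ∃ r, IsPolarOrbit H β η r ∧ 0 < turnTime H r ∧
        Function.Periodic X (turnTime H r) ∧ Function.Periodic Y (turnTime H r) ∧
        (∀ τ, 0 < τ → X τ = X 0 → Y τ = Y 0 → turnTime H r ≤ τ) ∧
        ∀ t, 0 < X t → Y t = X t * β (X t) →
          r (Real.arctan (-β (X t))) * Real.cos (Real.arctan (-β (X t))) = X t := by
  obtain ⟨η₁, hη₁, h1⟩ := h.exists_closing hH
  obtain ⟨η₂, hη₂, h2⟩ := h.exists_isPolarOrbit hH
  have hK : 0 ≤ K := (abs_nonneg _).trans (hHK 0)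
  obtain ⟨ρ, hρ, hρη, hρ1, hρ2⟩ : ∃ ρ > 0, ρ ≤ η ∧ ρ ≤ η₁ ∧ ρ ≤ η₂ :=
    ⟨min η (min η₁ η₂), lt_min hη (lt_min hη₁ hη₂), min_le_left _ _,
      (min_le_right _ _).trans (min_le_left _ _), (min_le_right _ _).trans (min_le_right _ _)⟩
  -- Chosen so that Grönwall keeps the radius below ρ for |t| ≤ 20, the time needed for closing up.
  refine ⟨ρ ^ 2 / Real.exp (3 * K * 20), by positivity, fun X Y hXY hN hmin hδ hclose => ?_⟩
  rw [le_div_iff₀ (Real.exp_pos _)] at hδ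
  have hsmall : ∀ t, |t| ≤ 20 → √(X t ^ 2 + Y t ^ 2) ≤ ρ := by
    intro t ht
    rw [Real.sqrt_le_left hρ.le]
    refine (hXY.sq_add_sq_le hHK hβK 0 t).trans (le_trans ?_ hδ)
    rw [sub_zero]
    exact mul_le_mul_of_nonneg_left (Real.exp_le_exp.2
      (mul_le_mul_of_nonneg_left ht (by positivity))) (by positivity)
  obtain ⟨T, hT0, hT20, hXT, hYT⟩ := h1 X Y hXY hN hmin fun t ht => (hsmall t ht.le).trans hρ1
  obtain ⟨pX, pY⟩ := hclose T hT0 hXT hYT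
  -- The period T is below 20, so the bound on one period holds for all times.
  have hall : ∀ t, √(X t ^ 2 + Y t ^ 2) ≤ ρ := by
    intro t
    have hp : Function.Periodic (fun t => √(X t ^ 2 + Y t ^ 2)) T := fun t => by
      simp only [pX t, pY t]
    obtain ⟨y, hy, hyt⟩ := hp.exists_mem_Ico₀ hT0 t
    rw [hyt]
    exact hsmall y (by rw [abs_of_nonneg hy.1]; linarith [hy.2])
  obtain ⟨r, hr, hrest⟩ := h2 ρ hρ2 X Y hXY hN hmin hall
  exact ⟨r, fun φ => ⟨(hr φ).1, (hr φ).2.1.trans hρη, (hr φ).2.2⟩, hrest⟩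

end LocalExpansion

/-! ### Limits of quotients at the origin -/

theorem tendsto_div_of_eventually_hasDerivAt {F G F' G' : ℝ → ℝ} {l : Filter ℝ}
    (hF : ∀ᶠ x in 𝓝 0, HasDerivAt F (F' x) x) (hG : ∀ᶠ x in 𝓝 0, HasDerivAt G (G' x) x)
    (hG' : ∀ᶠ x in 𝓝[≠] 0, G' x ≠ 0) (hF0 : F 0 = 0) (hG0 : G 0 = 0)
    (h : Tendsto (fun x => F' x / G' x) (𝓝[≠] 0) l) :
    Tendsto (fun x => F x / G x) (𝓝[≠] 0) l := by
  have h1 := hF.self_of_nhds.continuousAt.tendsto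
  have h2 := hG.self_of_nhds.continuousAt.tendsto
  rw [hF0] at h1
  rw [hG0] at h2
  exact HasDerivAt.lhopital_zero_nhdsNE (hF.filter_mono nhdsWithin_le_nhds)
    (hG.filter_mono nhdsWithin_le_nhds) hG' (h1.mono_left nhdsWithin_le_nhds)
    (h2.mono_left nhdsWithin_le_nhds) h

theorem tendsto_sub_div_of_hasDerivAt {F : ℝ → ℝ} {F' : ℝ} (h : HasDerivAt F F' 0) :
    Tendsto (fun x => (F x - F 0) / x) (𝓝[≠] 0) (𝓝 F') := by
  refine (hasDerivAt_iff_tendsto_slope.1 h).congr fun x => ?_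
  rw [slope_def_field, sub_zero]

theorem hasDerivAt_zero_of_tendsto {F : ℝ → ℝ} {F' : ℝ}
    (h : Tendsto (fun x => (F x - F 0) / x) (𝓝[≠] 0) (𝓝 F')) : HasDerivAt F F' 0 := by
  refine hasDerivAt_iff_tendsto_slope.2 (h.congr fun x => ?_)
  rw [slope_def_field, sub_zero]

/-! ### The weighted mean of the damping coefficient -/

/-- `x⁻² ∫ s f(s) ds`, the integral being over `[0, x]`. -/
noncomputable def dampingMean (f : ℝ → ℝ) (x : ℝ) : ℝ := (∫ s in (0:ℝ)..x, s * f s) / x ^ 2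

/-- The derivative of `dampingMean f` if `f₁` is the derivative of `f` at the origin. -/
noncomputable def dampingMeanDeriv (f : ℝ → ℝ) (f₁ x : ℝ) : ℝ :=
  if x = 0 then f₁ / 3 else f x / x - 2 * dampingMean f x / x

section damping

variable {f : ℝ → ℝ} {f₁ : ℝ}

theorem dampingMean_zero (f : ℝ → ℝ) : dampingMean f 0 = 0 := by simp [dampingMean]

theorem hasDerivAt_integral_mul (hf : Continuous f) (x : ℝ) :
    HasDerivAt (fun x => ∫ s in (0:ℝ)..x, s * f s) (x * f x) x := by
  have hc : Continuous fun s => s * f s := by fun_prop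
  exact intervalIntegral.integral_hasDerivAt_right (hc.intervalIntegrable _ _)
    (hc.stronglyMeasurableAtFilter _ _) hc.continuousAt

/-- L'Hôpital: the quotient of derivatives is x f(x)/(3x²). -/
theorem tendsto_dampingMean_div (hf : Continuous f) (hf0 : f 0 = 0) (hf1 : HasDerivAt f f₁ 0) :
    Tendsto (fun x => dampingMean f x / x) (𝓝[≠] 0) (𝓝 (f₁ / 3)) := by
  have h1 : Tendsto (fun x => (∫ s in (0:ℝ)..x, s * f s) / x ^ 3) (𝓝[≠] 0) (𝓝 (f₁ / 3)) := by
    refine tendsto_div_of_eventually_hasDerivAt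
      (Eventually.of_forall fun x => hasDerivAt_integral_mul hf x)
      (Eventually.of_forall fun x => hasDerivAt_pow 3 x) ?_ (by simp) (by simp) ?_
    · filter_upwards [self_mem_nhdsWithin] with x hx
      have : x ≠ 0 := hx
      positivity
    · refine ((tendsto_sub_div_of_hasDerivAt hf1).div_const 3).congr' ?_
      filter_upwards [self_mem_nhdsWithin] with x hx
      have : x ≠ 0 := hx
      rw [hf0]
      norm_num
      field_simp
  refine h1.congr fun x => ?_
  rw [dampingMean, div_div, ← pow_succ]

theorem hasDerivAt_dampingMean (hf : Continuous f) (hf0 : f 0 = 0) (hf1 : HasDerivAt f f₁ 0)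
    (x : ℝ) : HasDerivAt (dampingMean f) (dampingMeanDeriv f f₁ x) x := by
  by_cases hx : x = 0
  · subst hx
    rw [dampingMeanDeriv, if_pos rfl]
    refine hasDerivAt_zero_of_tendsto ?_
    simpa [dampingMean_zero] using tendsto_dampingMean_div hf hf0 hf1
  · rw [dampingMeanDeriv, if_neg hx]
    refine ((hasDerivAt_integral_mul hf x).div (hasDerivAt_pow 2 x)
      (pow_ne_zero 2 hx)).congr_deriv ?_
    rw [dampingMean]
    norm_num
    field_simp

/-- The limit is f₁ - 2f₁/3; differentiability of f at the single point 0 suffices. -/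
theorem tendsto_dampingMeanDeriv (hf : Continuous f) (hf0 : f 0 = 0) (hf1 : HasDerivAt f f₁ 0) :
    Tendsto (dampingMeanDeriv f f₁) (𝓝 0) (𝓝 (f₁ / 3)) := by
  rw [← pure_sup_nhdsNE, tendsto_sup]
  refine ⟨by simpa [dampingMeanDeriv] using tendsto_pure_nhds (dampingMeanDeriv f f₁) 0, ?_⟩
  have h1 := (tendsto_sub_div_of_hasDerivAt hf1).sub
    ((tendsto_dampingMean_div hf hf0 hf1).const_mul 2)
  rw [show f₁ - 2 * (f₁ / 3) = f₁ / 3 by ring] at h1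
  refine h1.congr' ?_
  filter_upwards [self_mem_nhdsWithin] with x hx
  rw [dampingMeanDeriv, if_neg (show x ≠ 0 from hx), hf0, sub_zero, mul_div_assoc]

theorem continuous_dampingMean (hf : Continuous f) (hf0 : f 0 = 0) (hf1 : HasDerivAt f f₁ 0) :
    Continuous (dampingMean f) :=
  continuous_iff_continuousAt.2 fun x => (hasDerivAt_dampingMean hf hf0 hf1 x).continuousAt

/-- This identity motivates the choice of the mean: it lets f cancel from the equation for Y and
leaves the same coefficient in both equations. -/
theorem hasDerivAt_mul_dampingMean (hf : Continuous f) (hf0 : f 0 = 0) (hf1 : HasDerivAt f f₁ 0)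
    (x : ℝ) : HasDerivAt (fun x => x * dampingMean f x) (f x - dampingMean f x) x := by
  refine ((hasDerivAt_id x).mul (hasDerivAt_dampingMean hf hf0 hf1 x)).congr_deriv ?_
  by_cases hx : x = 0
  · simp [hx, hf0, dampingMean_zero]
  · rw [dampingMeanDeriv, if_neg hx]
    simp only [id]
    field_simp
    ring

end damping

/-! ### The difference quotient of the restoring force -/

/-- The derivative of `dslope g 0`, in terms of the derivatives `g'` and `g''` of `g`. -/
noncomputable def dslopeDeriv (g g' g'' : ℝ → ℝ) (x : ℝ) : ℝ :=
  if x = 0 then g'' 0 / 2 else (x * g' x - g x) / x ^ 2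

section dslope

variable {g g' g'' : ℝ → ℝ} {g₃ : ℝ}

theorem eventually_hasDerivAt_dslope (hg0 : g 0 = 0) (hg : ∀ᶠ x in 𝓝 0, HasDerivAt g (g' x) x)
    (hg' : ∀ᶠ x in 𝓝 0, HasDerivAt g' (g'' x) x) :
    ∀ᶠ x in 𝓝 0, HasDerivAt (dslope g 0) (dslopeDeriv g g' g'' x) x := by
  have hd : deriv g 0 = g' 0 := hg.self_of_nhds.deriv
  have hne : ∀ x ≠ 0, dslope g 0 x = g x / x := fun x hx => by
    rw [dslope_of_ne _ hx, slope_def_field, hg0, sub_zero, sub_zero]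
  rw [← pure_sup_nhdsNE, eventually_sup, eventually_pure]
  constructor
  · rw [dslopeDeriv, if_pos rfl]
    refine hasDerivAt_zero_of_tendsto ?_
    have h1 : Tendsto (fun x => (g x - g' 0 * x) / x ^ 2) (𝓝[≠] 0) (𝓝 (g'' 0 / 2)) := by
      refine tendsto_div_of_eventually_hasDerivAt (F' := fun x => g' x - g' 0)
        (G' := fun x => 2 * x) ?_ ?_ ?_ (by simp [hg0]) (by simp) ?_
      · exact hg.mono fun x hx => (hx.sub ((hasDerivAt_id x).const_mul (g' 0))).congr_deriv
          (by simp)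
      · exact Eventually.of_forall fun x => (hasDerivAt_pow 2 x).congr_deriv (by simp)
      · filter_upwards [self_mem_nhdsWithin] with x hx
        have : x ≠ 0 := hx
        positivity
      · refine ((tendsto_sub_div_of_hasDerivAt hg'.self_of_nhds).div_const 2).congr fun x => ?_
        rw [div_div, mul_comm x]
    refine h1.congr' ?_
    filter_upwards [self_mem_nhdsWithin] with x hx
    have : x ≠ 0 := hx
    rw [hne x hx, dslope_same, hd]
    field_simp
  · filter_upwards [self_mem_nhdsWithin, hg.filter_mono nhdsWithin_le_nhds] with x hx hgx
    have hx0 : x ≠ 0 := hx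
    rw [dslopeDeriv, if_neg hx0]
    refine ((hgx.div (hasDerivAt_id x) hx0).congr_deriv ?_).congr_of_eventuallyEq ?_
    · simp only [id]
      ring
    · filter_upwards [isOpen_ne.mem_nhds hx0] with y hy
      exact hne y hy

/-- One application of L'Hôpital reduces the claim to the difference quotient of g'' at 0. -/
theorem isLittleO_dslopeDeriv (hg0 : g 0 = 0) (hg : ∀ᶠ x in 𝓝 0, HasDerivAt g (g' x) x)
    (hg' : ∀ᶠ x in 𝓝 0, HasDerivAt g' (g'' x) x) (hg'' : HasDerivAt g'' g₃ 0) :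
    (fun x => dslopeDeriv g g' g'' x - g'' 0 / 2 - g₃ / 3 * x) =o[𝓝 0] fun x => x := by
  rw [← pure_sup_nhdsNE]
  refine Asymptotics.IsLittleO.sup (Asymptotics.isLittleO_pure.2 (by simp [dslopeDeriv])) ?_
  have h1 : Tendsto (fun x => (x * g' x - g x - g'' 0 / 2 * x ^ 2) / x ^ 3) (𝓝[≠] 0)
      (𝓝 (g₃ / 3)) := by
    refine tendsto_div_of_eventually_hasDerivAt (F' := fun x => x * (g'' x - g'' 0))
      (G' := fun x => 3 * x ^ 2) ?_ ?_ ?_ (by simp [hg0]) (by simp) ?_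
    · filter_upwards [hg, hg'] with x h2 h3
      refine ((((hasDerivAt_id x).mul h3).sub h2).sub
        ((hasDerivAt_pow 2 x).const_mul (g'' 0 / 2))).congr_deriv ?_
      simp only [id]
      norm_num
      ring
    · exact Eventually.of_forall fun x => (hasDerivAt_pow 3 x).congr_deriv (by simp)
    · filter_upwards [self_mem_nhdsWithin] with x hx
      have : x ≠ 0 := hx
      positivity
    · refine ((tendsto_sub_div_of_hasDerivAt hg'').div_const 3).congr' ?_
      filter_upwards [self_mem_nhdsWithin] with x hx
      have : x ≠ 0 := hx
      field_simp
  rw [Asymptotics.isLittleO_iff_tendsto' (by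
    filter_upwards [self_mem_nhdsWithin] with x hx h0 using absurd h0 hx)]
  have h2 := h1.sub_const (g₃ / 3)
  rw [sub_self] at h2
  refine h2.congr' ?_
  filter_upwards [self_mem_nhdsWithin] with x hx
  have hx0 : x ≠ 0 := hx
  rw [dslopeDeriv, if_neg hx0]
  field_simp

end dslope

/-! ### The normalized system of a Liénard equation -/

theorem LocalExpansion.congr {H β H₀ β₀ H' β' : ℝ → ℝ} {p₀ p₁ q₀ : ℝ}
    (h : LocalExpansion H₀ β₀ H' β' p₀ p₁ q₀) (hH : H =ᶠ[𝓝 0] H₀) (hβ : β =ᶠ[𝓝 0] β₀) :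
    LocalExpansion H β H' β' p₀ p₁ q₀ where
  H_zero := hH.self_of_nhds.trans h.H_zero
  β_zero := hβ.self_of_nhds.trans h.β_zero
  hasDerivAt_H := by
    filter_upwards [h.hasDerivAt_H, hH.eventuallyEq_nhds] with x h1 h2 using
      h1.congr_of_eventuallyEq h2
  hasDerivAt_β := by
    filter_upwards [h.hasDerivAt_β, hβ.eventuallyEq_nhds] with x h1 h2 using
      h1.congr_of_eventuallyEq h2
  isLittleO_H' := h.isLittleO_H'
  tendsto_β' := h.tendsto_β'

/-- The nearest point projection to `[a, b]`. -/
noncomputable def clamp (a b x : ℝ) : ℝ := max a (min b x)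

theorem continuous_clamp (a b : ℝ) : Continuous (clamp a b) := by
  unfold clamp; fun_prop

theorem clamp_of_mem {a b x : ℝ} (hx : x ∈ Icc a b) : clamp a b x = x := by
  rw [clamp, min_eq_right hx.2, max_eq_right hx.1]

theorem clamp_mem {a b : ℝ} (hab : a ≤ b) (x : ℝ) : clamp a b x ∈ Icc a b :=
  ⟨le_max_left _ _, max_le hab (min_le_left _ _)⟩

/-- The damping coefficient of the normalized system. -/
noncomputable def dampingCoeff (a b ω : ℝ) (f : ℝ → ℝ) (X : ℝ) : ℝ :=
  dampingMean f (clamp a b (X / ω)) / ω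

/-- The nonlinear part of the restoring coefficient of the normalized system. -/
noncomputable def restoringCoeff (a b ω : ℝ) (f g : ℝ → ℝ) (X : ℝ) : ℝ :=
  dslope g 0 (clamp a b (X / ω)) / ω ^ 2 - 1 - dampingCoeff a b ω f X ^ 2

section coefficients

variable {a b ω : ℝ} {f g g' g'' : ℝ → ℝ} {f₁ g₃ : ℝ}

/-- The summand -β² contributes -q₀² = -f₁²/(9ω⁴) to p₁; this is the origin of the term with f'(0)²
in Q. -/
theorem localExpansion_coeff (ha : a < 0) (hb : 0 < b) (hω : 0 < ω) (hf : Continuous f)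
    (hf0 : f 0 = 0) (hf1 : HasDerivAt f f₁ 0) (hg0 : g 0 = 0)
    (hg : ∀ᶠ x in 𝓝 0, HasDerivAt g (g' x) x) (hg' : ∀ᶠ x in 𝓝 0, HasDerivAt g' (g'' x) x)
    (hg'' : HasDerivAt g'' g₃ 0) (hω2 : ω ^ 2 = g' 0) :
    ∃ H' β', LocalExpansion (restoringCoeff a b ω f g) (dampingCoeff a b ω f) H' β'
      (g'' 0 / (2 * ω ^ 3)) ((g₃ - 2 / 3 * f₁ ^ 2) / (6 * ω ^ 4)) (f₁ / (3 * ω ^ 2)) := by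
  have hdiv : Tendsto (fun X : ℝ => X / ω) (𝓝 0) (𝓝 0) := by
    simpa using (tendsto_id (α := ℝ) (x := 𝓝 0)).div_const ω
  have hdd : ∀ X : ℝ, HasDerivAt (fun X : ℝ => X / ω) (1 / ω) X := fun X =>
    (hasDerivAt_id X).div_const ω
  have hcl : ∀ᶠ X in 𝓝 (0:ℝ), clamp a b (X / ω) = X / ω := by
    filter_upwards [hdiv.eventually (Icc_mem_nhds ha hb)] with X hX using clamp_of_mem hX
  set β₀ : ℝ → ℝ := fun X => dampingMean f (X / ω) / ω with hβ₀
  set H₀ : ℝ → ℝ := fun X => dslope g 0 (X / ω) / ω ^ 2 - 1 - β₀ X ^ 2 with hH₀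
  set β' : ℝ → ℝ := fun X => dampingMeanDeriv f f₁ (X / ω) / ω ^ 2 with hβ'
  set H' : ℝ → ℝ := fun X => dslopeDeriv g g' g'' (X / ω) / ω ^ 3 - 2 * β₀ X * β' X with hH'
  have hβd : ∀ X, HasDerivAt β₀ (β' X) X := fun X => by
    have h1 := ((hasDerivAt_dampingMean hf hf0 hf1 (X / ω)).comp X (hdd X)).div_const ω
    refine h1.congr_deriv ?_
    simp only [hβ']
    field_simp
  have hβ0 : β₀ 0 = 0 := by simp [hβ₀, dampingMean_zero]
  have hβt : Tendsto β' (𝓝 0) (𝓝 (f₁ / (3 * ω ^ 2))) := by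
    have h1 := ((tendsto_dampingMeanDeriv hf hf0 hf1).comp hdiv).div_const (ω ^ 2)
    rwa [div_div] at h1
  have h0 : LocalExpansion H₀ β₀ H' β' (g'' 0 / (2 * ω ^ 3))
      ((g₃ - 2 / 3 * f₁ ^ 2) / (6 * ω ^ 4)) (f₁ / (3 * ω ^ 2)) := by
    refine ⟨?_, hβ0, ?_, Eventually.of_forall hβd, ?_, hβt⟩
    · simp only [hH₀, hβ0, zero_div, dslope_same]
      rw [hg.self_of_nhds.deriv, ← hω2, div_self (by positivity)]
      norm_num
    · filter_upwards [hdiv.eventually (eventually_hasDerivAt_dslope hg0 hg hg')] with X hX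
      have h1 := (((hX.comp X (hdd X)).div_const (ω ^ 2)).sub_const 1).sub ((hβd X).pow 2)
      refine h1.congr_deriv ?_
      simp only [hH']
      norm_num
      field_simp
    · have e1 : (fun X => dslopeDeriv g g' g'' (X / ω) - g'' 0 / 2 - g₃ / 3 * (X / ω))
          =o[𝓝 0] fun X => X := by
        refine ((isLittleO_dslopeDeriv hg0 hg hg' hg'').comp_tendsto hdiv).trans_isBigO ?_
        have := (Asymptotics.isBigO_refl (fun X : ℝ => X) (𝓝 0)).const_mul_left ω⁻¹
        refine this.congr_left fun X => ?_
        simp [div_eq_inv_mul]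
      have e2 : (fun X => β₀ X - f₁ / (3 * ω ^ 2) * X) =o[𝓝 0] fun X => X := by
        have h1 := hasDerivAt_iff_isLittleO.1 (hβd 0)
        have h2 : β' 0 = f₁ / (3 * ω ^ 2) := by
          simp [hβ', dampingMeanDeriv, div_div]
        simpa [hβ0, h2, mul_comm] using h1
      have e3 : (fun X => β' X - f₁ / (3 * ω ^ 2)) =o[𝓝 0] fun _ => (1 : ℝ) := by
        rw [Asymptotics.isLittleO_one_iff]
        have h1 := hβt.sub_const (f₁ / (3 * ω ^ 2))
        rwa [sub_self] at h1
      have e4 : β' =O[𝓝 0] fun _ => (1 : ℝ) := hβt.isBigO_one ℝ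
      have e5 : (fun X => β' X * (β₀ X - f₁ / (3 * ω ^ 2) * X)) =o[𝓝 0] fun X => X := by
        simpa using e4.mul_isLittleO e2
      have e6 : (fun X => (β' X - f₁ / (3 * ω ^ 2)) * X) =o[𝓝 0] fun X => X := by
        simpa using e3.mul_isBigO (Asymptotics.isBigO_refl (fun X : ℝ => X) (𝓝 0))
      have key := ((e1.const_mul_left (1 / ω ^ 3)).sub (e5.const_mul_left 2)).sub
        (e6.const_mul_left (2 * (f₁ / (3 * ω ^ 2))))
      refine key.congr_left fun X => ?_
      simp only [hH']
      field_simp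
      ring
  refine ⟨H', β', h0.congr ?_ ?_⟩
  · filter_upwards [hcl] with X hX
    simp only [restoringCoeff, dampingCoeff, hX, hH₀, hβ₀]
  · filter_upwards [hcl] with X hX
    simp only [dampingCoeff, hX, hβ₀]

theorem continuous_dampingCoeff (hf : Continuous f) (hf0 : f 0 = 0) (hf1 : HasDerivAt f f₁ 0) :
    Continuous (dampingCoeff a b ω f) :=
  ((continuous_dampingMean hf hf0 hf1).comp
    ((continuous_clamp a b).comp (continuous_id.div_const ω))).div_const ω

theorem continuous_dslope (hg : Continuous g) (hd : DifferentiableAt ℝ g 0) :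
    Continuous (dslope g 0) := by
  rw [← continuousOn_univ]
  exact (continuousOn_dslope univ_mem).2 ⟨hg.continuousOn, hd⟩

theorem continuous_restoringCoeff (hf : Continuous f) (hf0 : f 0 = 0) (hf1 : HasDerivAt f f₁ 0)
    (hg : Continuous g) (hd : DifferentiableAt ℝ g 0) :
    Continuous (restoringCoeff a b ω f g) :=
  ((((continuous_dslope hg hd).comp ((continuous_clamp a b).comp
    (continuous_id.div_const ω))).div_const (ω ^ 2)).sub continuous_const).sub
    ((continuous_dampingCoeff hf hf0 hf1).pow 2)

/-- By clamping, the coefficients factor through the compact interval [a, b]. -/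
theorem exists_abs_coeff_le (hab : a ≤ b) (hf : Continuous f) (hf0 : f 0 = 0)
    (hf1 : HasDerivAt f f₁ 0) (hg : Continuous g) (hd : DifferentiableAt ℝ g 0) :
    ∃ K, (∀ X, |restoringCoeff a b ω f g X| ≤ K) ∧ ∀ X, |dampingCoeff a b ω f X| ≤ K := by
  have hc := continuous_dampingMean hf hf0 hf1
  obtain ⟨K₁, h1⟩ := isCompact_Icc.exists_bound_of_continuousOn (s := Icc a b)
    (f := fun x => dslope g 0 x / ω ^ 2 - 1 - (dampingMean f x / ω) ^ 2)
    ((((continuous_dslope hg hd).div_const _).sub continuous_const).sub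
      ((hc.div_const ω).pow 2)).continuousOn
  obtain ⟨K₂, h2⟩ := isCompact_Icc.exists_bound_of_continuousOn (s := Icc a b)
    (f := fun x => dampingMean f x / ω) (hc.div_const ω).continuousOn
  exact ⟨max K₁ K₂, fun X => (h1 _ (clamp_mem hab (X / ω))).trans (le_max_left _ _),
    fun X => (h2 _ (clamp_mem hab (X / ω))).trans (le_max_right _ _)⟩

/-- Phase curves are solutions of the normalized system. -/
theorem IsPhaseCurve.isSystemCurve {z : ℝ → ℝ × ℝ} (hz : IsPhaseCurve f g (Icc a b) z)
    (hω : 0 < ω) (hf : Continuous f) (hf0 : f 0 = 0) (hf1 : HasDerivAt f f₁ 0) (hg0 : g 0 = 0)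
    (t₁ : ℝ) :
    IsSystemCurve (restoringCoeff a b ω f g) (dampingCoeff a b ω f)
      (fun s => ω * (z (t₁ + s / ω)).1)
      (fun s => (z (t₁ + s / ω)).2 + (z (t₁ + s / ω)).1 * dampingMean f (z (t₁ + s / ω)).1) := by
  intro s
  obtain ⟨hmem, hd⟩ := hz (t₁ + s / ω)
  have htime : HasDerivAt (fun s : ℝ => t₁ + s / ω) (1 / ω) s :=
    ((hasDerivAt_id s).div_const ω).const_add t₁
  have hd1 : HasDerivAt (fun s => (z (t₁ + s / ω)).1) ((z (t₁ + s / ω)).2 * (1 / ω)) s :=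
    HasDerivAt.comp s (h₂ := fun t => (z t).1) hd.fst htime
  have hd2 : HasDerivAt (fun s => (z (t₁ + s / ω)).2)
      ((-(f (z (t₁ + s / ω)).1) * (z (t₁ + s / ω)).2 - g (z (t₁ + s / ω)).1) * (1 / ω)) s :=
    HasDerivAt.comp s (h₂ := fun t => (z t).2) hd.snd htime
  -- The summand (f - m)x' cancels the damping -f x' in the derivative of Y and leaves -m x'.
  have hd3 := HasDerivAt.comp s (hasDerivAt_mul_dampingMean hf hf0 hf1 (z (t₁ + s / ω)).1) hd1
  have hβ : dampingCoeff a b ω f (ω * (z (t₁ + s / ω)).1) =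
      dampingMean f (z (t₁ + s / ω)).1 / ω := by
    rw [dampingCoeff, mul_div_cancel_left₀ _ hω.ne', clamp_of_mem hmem]
  have hH : restoringCoeff a b ω f g (ω * (z (t₁ + s / ω)).1) =
      dslope g 0 (z (t₁ + s / ω)).1 / ω ^ 2 - 1 - (dampingMean f (z (t₁ + s / ω)).1 / ω) ^ 2 := by
    rw [restoringCoeff, hβ, mul_div_cancel_left₀ _ hω.ne', clamp_of_mem hmem]
  have hg : (z (t₁ + s / ω)).1 * dslope g 0 (z (t₁ + s / ω)).1 = g (z (t₁ + s / ω)).1 := by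
    have := sub_smul_dslope g 0 (z (t₁ + s / ω)).1
    rwa [sub_zero, hg0, sub_zero, smul_eq_mul] at this
  constructor
  · refine (hd1.const_mul ω).congr_deriv ?_
    simp only [hβ]
    field_simp
    ring
  · refine (hd2.add hd3).congr_deriv ?_
    simp only [hβ, hH]
    rw [← hg]
    field_simp
    ring

end coefficients

/-! ### Uniqueness of periodic phase curves -/

theorem IsPhaseCurve.continuous {f g : ℝ → ℝ} {J : Set ℝ} {z : ℝ → ℝ × ℝ}
    (hz : IsPhaseCurve f g J z) : Continuous z :=
  continuous_iff_continuousAt.2 fun t => (hz t).2.continuousAt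

/-- Periodic curves are bounded, hence stay in a compact convex rectangle, where the C¹ vector field
is Lipschitz. -/
theorem IsPhaseCurve.eq_of_periodic {f g : ℝ → ℝ} {a b : ℝ} {z w : ℝ → ℝ × ℝ}
    (hf : ContDiffOn ℝ 1 f (Icc a b)) (hg : ContDiffOn ℝ 1 g (Icc a b))
    (hz : IsPhaseCurve f g (Icc a b) z) (hw : IsPhaseCurve f g (Icc a b) w) {τ σ t₀ : ℝ}
    (hτ : 0 < τ) (hσ : 0 < σ) (hzτ : Function.Periodic z τ) (hwσ : Function.Periodic w σ)
    (h0 : z t₀ = w t₀) : z = w := by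
  obtain ⟨R₁, hR₁⟩ := (hzτ.isBounded_of_continuous hτ.ne' hz.continuous).exists_norm_le
  obtain ⟨R₂, hR₂⟩ := (hwσ.isBounded_of_continuous hσ.ne' hw.continuous).exists_norm_le
  set R := max R₁ R₂
  have hv : ContDiffOn ℝ 1 (fun p : ℝ × ℝ => (p.2, -(f p.1) * p.2 - g p.1))
      (Icc a b ×ˢ Icc (-R) R) := by
    have h1 : ContDiffOn ℝ 1 (fun p : ℝ × ℝ => f p.1) (Icc a b ×ˢ Icc (-R) R) :=
      hf.comp contDiff_fst.contDiffOn fun p hp => hp.1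
    have h2 : ContDiffOn ℝ 1 (fun p : ℝ × ℝ => g p.1) (Icc a b ×ˢ Icc (-R) R) :=
      hg.comp contDiff_fst.contDiffOn fun p hp => hp.1
    exact contDiff_snd.contDiffOn.prodMk ((h1.neg.mul contDiff_snd.contDiffOn).sub h2)
  obtain ⟨K, hK⟩ := hv.exists_lipschitzOnWith one_ne_zero
    ((convex_Icc a b).prod (convex_Icc (-R) R)) (isCompact_Icc.prod isCompact_Icc)
  refine ODE_solution_unique_univ (v := fun _ p => (p.2, -(f p.1) * p.2 - g p.1))
    (s := fun _ => Icc a b ×ˢ Icc (-R) R) (K := K) (t₀ := t₀) (fun _ => hK)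
    (fun t => ⟨(hz t).2, (hz t).1, ?_⟩) (fun t => ⟨(hw t).2, (hw t).1, ?_⟩) h0
  · exact abs_le.1 ((norm_snd_le (z t)).trans ((hR₁ _ (mem_range_self t)).trans (le_max_left _ _)))
  · exact abs_le.1 ((norm_snd_le (w t)).trans ((hR₂ _ (mem_range_self t)).trans (le_max_right _ _)))

theorem IsPhaseCurve.shift {f g : ℝ → ℝ} {J : Set ℝ} {z : ℝ → ℝ × ℝ}
    (hz : IsPhaseCurve f g J z) (T : ℝ) : IsPhaseCurve f g J fun t => z (t + T) := fun t =>
  ⟨(hz (t + T)).1, (hz (t + T)).2.comp_add_const t T⟩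

/-- Uniqueness applied to the curve and its translate by T, which agree at t₁. -/
theorem IsPhaseCurve.periodic_of_eq {f g : ℝ → ℝ} {a b : ℝ} {z : ℝ → ℝ × ℝ}
    (hf : ContDiffOn ℝ 1 f (Icc a b)) (hg : ContDiffOn ℝ 1 g (Icc a b))
    (hz : IsPhaseCurve f g (Icc a b) z) {τ t₁ T : ℝ} (hτ : 0 < τ) (hzτ : Function.Periodic z τ)
    (h : z (t₁ + T) = z t₁) : Function.Periodic z T := fun t =>
  congrFun (IsPhaseCurve.eq_of_periodic hf hg (hz.shift T) hz hτ hτ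
    (fun t => by rw [add_right_comm, hzτ]) hzτ h) t

theorem IsPhaseCurve.congr {f g F G : ℝ → ℝ} {J : Set ℝ} {z : ℝ → ℝ × ℝ}
    (hz : IsPhaseCurve f g J z) (hF : EqOn F f J) (hG : EqOn G g J) : IsPhaseCurve F G J z :=
  fun t => ⟨(hz t).1, by rw [hF (hz t).1, hG (hz t).1]; exact (hz t).2⟩

/-! ### Cycles of the Liénard equation -/

/-- The cycle through `(c, 0)` as a closed orbit of the normalized system. -/
structure IsNormalizedCycle (f g : ℝ → ℝ) (J : Set ℝ) (H β : ℝ → ℝ) (ω η c : ℝ)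
    (z : ℝ → ℝ × ℝ) (r : ℝ → ℝ) : Prop where
  isPhaseCurve : IsPhaseCurve f g J z
  apply_zero : z 0 = (c, 0)
  isPolarOrbit : IsPolarOrbit H β η r
  abscissa : r (Real.arctan (-β (ω * c))) * Real.cos (Real.arctan (-β (ω * c))) = ω * c
  isLeast : IsLeast {τ : ℝ | 0 < τ ∧ Function.Periodic z τ} (turnTime H r / ω)
  periodFunction_eq : periodFunction f g J c = turnTime H r / ω

/-- By uniqueness, every solution admitted in the infimum is z. -/
theorem periodFunction_eq_of_isLeast {f g : ℝ → ℝ} {a b c τ : ℝ} {z : ℝ → ℝ × ℝ}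
    (hf : ContDiffOn ℝ 1 f (Icc a b)) (hg : ContDiffOn ℝ 1 g (Icc a b))
    (hz : IsPhaseCurve f g (Icc a b) z) (hz0 : z 0 = (c, 0))
    (hτ : IsLeast {τ : ℝ | 0 < τ ∧ Function.Periodic z τ} τ) :
    periodFunction f g (Icc a b) c = τ := by
  have : {τ : ℝ | 0 < τ ∧ ∃ z : ℝ → ℝ × ℝ, IsPhaseCurve f g (Icc a b) z ∧ z 0 = (c, 0) ∧
      Function.Periodic z τ} = {τ : ℝ | 0 < τ ∧ Function.Periodic z τ} := by
    ext σ
    constructor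
    · rintro ⟨hσ, w, hw, hw0, hwσ⟩
      have := hz.eq_of_periodic hf hg hw hτ.1.1 hσ hτ.1.2 hwσ (hz0.trans hw0.symm)
      exact ⟨hσ, this ▸ hwσ⟩
    · rintro ⟨hσ, hzσ⟩
      exact ⟨hσ, z, hz, hz0, hzσ⟩
  rw [periodFunction, this]
  exact hτ.csInf_eq

/-- Near a center, the solutions that start at `(c, 0)` are small closed orbits. -/
theorem exists_isNormalizedCycle {a b ω : ℝ} {f g F G : ℝ → ℝ} {f₁ : ℝ}
    {H' β' : ℝ → ℝ} {p₀ p₁ q₀ : ℝ} (hab : a ≤ b) (hω : 0 < ω)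
    (hf : ContDiffOn ℝ 1 f (Icc a b)) (hg : ContDiffOn ℝ 1 g (Icc a b))
    (hcenter : IsCenterAtOrigin f g (Icc a b)) (hFf : EqOn F f (Icc a b))
    (hGg : EqOn G g (Icc a b)) (hF : Continuous F) (hF0 : F 0 = 0) (hF1 : HasDerivAt F f₁ 0)
    (hG : Continuous G) (hG0 : G 0 = 0) (hG1 : DifferentiableAt ℝ G 0)
    (h : LocalExpansion (restoringCoeff a b ω F G) (dampingCoeff a b ω F) H' β' p₀ p₁ q₀)
    {η : ℝ} (hη : 0 < η) :
    ∃ δ > 0, ∀ c ∈ Ioo 0 δ, ∃ z r, IsNormalizedCycle f g (Icc a b)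
      (restoringCoeff a b ω F G) (dampingCoeff a b ω F) ω η c z r := by
  obtain ⟨K, hK1, hK2⟩ := exists_abs_coeff_le (ω := ω) hab hF hF0 hF1 hG hG1
  obtain ⟨δ₁, hδ₁, hsmall⟩ := h.exists_small_orbit (continuous_restoringCoeff hF hF0 hF1 hG hG1)
    hK1 hK2 hη
  obtain ⟨hzero, U, hU, hcyc⟩ := hcenter
  have hmc := continuous_dampingMean hF hF0 hF1
  have hev1 : ∀ᶠ c in 𝓝 (0:ℝ), ((c, 0) : ℝ × ℝ) ∈ U := by
    have hc : Continuous fun c : ℝ => ((c, 0) : ℝ × ℝ) := by fun_prop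
    exact hc.continuousAt.eventually hU
  have hev2 : ∀ᶠ c in 𝓝 (0:ℝ), (ω * c) ^ 2 + (0 + c * dampingMean F c) ^ 2 < δ₁ := by
    have hc : Continuous fun c : ℝ => (ω * c) ^ 2 + (0 + c * dampingMean F c) ^ 2 := by fun_prop
    have h1 := hc.tendsto 0
    simp only [mul_zero, zero_mul, add_zero, ne_eq, OfNat.ofNat_ne_zero, not_false_eq_true,
      zero_pow] at h1
    exact h1.eventually_lt_const hδ₁
  obtain ⟨δ, hδ, hball⟩ := Metric.eventually_nhds_iff.1 (hev1.and hev2)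
  refine ⟨δ, hδ, fun c hc => ?_⟩
  obtain ⟨hcU, hcδ⟩ := hball (y := c) (by
    rw [Real.dist_eq, sub_zero, abs_of_pos hc.1]; exact hc.2)
  obtain ⟨z, hz, hz0, -, τ, hτ, hzτ⟩ := hcyc (c, 0) hcU (fun h0 => hc.1.ne' (congrArg Prod.fst h0))
  -- The cycle cannot meet the equilibrium, whose constant solution has any positive period; 1 is
  -- used.
  have hne : ∀ t, z t ≠ (0, 0) := fun t ht => by
    have h1 := hz.eq_of_periodic hf hg hzero hτ one_pos hzτ (fun _ => rfl) ht
    have h2 := congrFun h1 0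
    rw [hz0] at h2
    exact hc.1.ne' (congrArg Prod.fst h2)
  set N : ℝ → ℝ := fun t => (ω * (z t).1) ^ 2 + ((z t).2 + (z t).1 * dampingMean F (z t).1) ^ 2
    with hN
  have hzc := hz.continuous
  have hNc : Continuous N := by fun_prop
  have hNpos : ∀ t, 0 < N t := fun t => by
    refine lt_of_le_of_ne (by positivity) fun h0 => hne t ?_
    have h1 : (ω * (z t).1) ^ 2 = 0 ∧ ((z t).2 + (z t).1 * dampingMean F (z t).1) ^ 2 = 0 :=
      (add_eq_zero_iff_of_nonneg (sq_nonneg _) (sq_nonneg _)).1 h0.symm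
    have h2 : (z t).1 = 0 := (mul_eq_zero.1 (pow_eq_zero_iff two_ne_zero |>.1 h1.1)).resolve_left
      hω.ne'
    have h3 := pow_eq_zero_iff two_ne_zero |>.1 h1.2
    rw [h2, zero_mul, add_zero] at h3
    exact Prod.ext h2 h3
  have hNper : Function.Periodic N τ := fun t => by simp only [hN, hzτ t]
  -- Time is restarted at a point of minimal normalized radius, as the closing argument requires.
  obtain ⟨t₁, -, ht₁⟩ := isCompact_Icc.exists_isMinOn (nonempty_Icc.2 hτ.le) hNc.continuousOn
  have hmin : ∀ t, N t₁ ≤ N t := fun t => by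
    obtain ⟨s, hs, hst⟩ := hNper.exists_mem_Ico₀ hτ t
    rw [hst]
    exact isMinOn_iff.1 ht₁ s (Ico_subset_Icc_self hs)
  have hzFG : IsPhaseCurve F G (Icc a b) z := hz.congr hFf hGg
  have hback : ∀ s s' : ℝ, ω * (z s).1 = ω * (z s').1 →
      (z s).2 + (z s).1 * dampingMean F (z s).1 = (z s').2 + (z s').1 * dampingMean F (z s').1 →
      z s = z s' := fun s s' h1 h2 => by
    have h3 := mul_left_cancel₀ hω.ne' h1
    rw [h3] at h2
    exact Prod.ext h3 (add_right_cancel h2)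
  obtain ⟨r, hr, hpos, hXp, hYp, hleast, habs⟩ := hsmall _ _
    (hzFG.isSystemCurve hω hF hF0 hF1 hG0 t₁) (fun s => hNpos _)
    (fun s => by simpa only [zero_div, add_zero] using hmin (t₁ + s / ω))
    (by
      have h1 := (hmin 0).trans_lt (by simpa only [hN, hz0] using hcδ)
      simpa only [zero_div, add_zero] using h1.le)
    (fun T hT hX hY => by
      have h1 := hback _ _ hX hY
      rw [zero_div, add_zero] at h1
      have h2 := hz.periodic_of_eq hf hg hτ hzτ h1
      have h3 : ∀ s, z (t₁ + (s + T) / ω) = z (t₁ + s / ω) := fun s => by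
        rw [add_div, ← add_assoc, h2]
      exact ⟨fun s => by simp only [h3], fun s => by simp only [h3]⟩)
  have hzT : Function.Periodic z (turnTime (restoringCoeff a b ω F G) r / ω) := by
    refine hz.periodic_of_eq hf hg hτ hzτ (t₁ := t₁) ?_
    have h1 := hback _ _ (hXp 0) (hYp 0)
    simpa only [zero_add, zero_div, add_zero] using h1
  have hIsLeast : IsLeast {τ : ℝ | 0 < τ ∧ Function.Periodic z τ}
      (turnTime (restoringCoeff a b ω F G) r / ω) := by
    refine ⟨⟨div_pos hpos hω, hzT⟩, fun σ hσ => ?_⟩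
    obtain ⟨hσ0, hσp⟩ := hσ
    have h1 : z (t₁ + ω * σ / ω) = z (t₁ + 0 / ω) := by
      rw [mul_div_cancel_left₀ _ hω.ne', hσp, zero_div, add_zero]
    rw [div_le_iff₀ hω, mul_comm]
    exact hleast (ω * σ) (mul_pos hω hσ0) (by simp only [h1]) (by simp only [h1])
  refine ⟨z, r, hz, hz0, hr, ?_, hIsLeast, periodFunction_eq_of_isLeast hf hg hz hz0 hIsLeast⟩
  -- In normalized time counted from t₁, the point (c, 0) is passed at -ωt₁; there x' = 0, so Y =
  -- Xβ(X).
  have ht : t₁ + -(ω * t₁) / ω = 0 := by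
    field_simp
    ring
  have h1 := habs (-(ω * t₁))
  simp only [ht, hz0] at h1
  refine h1 (mul_pos hω hc.1) ?_
  have hcmem : c ∈ Icc a b := by
    have := (hz 0).1
    rwa [hz0] at this
  rw [dampingCoeff, mul_div_cancel_left₀ _ hω.ne', clamp_of_mem hcmem]
  field_simp
  ring

/-! ### Proof of the theorem -/

/-- The local data of the coefficients of a Liénard equation at the origin. -/
theorem exists_derivatives {a b : ℝ} (ha : a < 0) (hb : 0 < b) {g : ℝ → ℝ}
    (hg : ContDiffOn ℝ 3 g (Icc a b)) :
    (∀ᶠ x in 𝓝 0, HasDerivAt g (deriv g x) x) ∧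
      (∀ᶠ x in 𝓝 0, HasDerivAt (deriv g) (iteratedDeriv 2 g x) x) ∧
      HasDerivAt (iteratedDeriv 2 g) (iteratedDeriv 3 g 0) 0 := by
  have hI : IsOpen (Ioo a b) := isOpen_Ioo
  have h0 : Ioo a b ∈ 𝓝 (0:ℝ) := Ioo_mem_nhds ha hb
  have hg3 : ContDiffOn ℝ (2 + 1) g (Ioo a b) := by
    norm_num
    exact hg.mono Ioo_subset_Icc_self
  obtain ⟨d1, -, hg2⟩ := (contDiffOn_succ_iff_deriv_of_isOpen hI).1 hg3
  have hg2' : ContDiffOn ℝ (1 + 1) (deriv g) (Ioo a b) := by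
    norm_num
    exact hg2
  obtain ⟨d2, -, hg1⟩ := (contDiffOn_succ_iff_deriv_of_isOpen hI).1 hg2'
  have d3 := hg1.differentiableOn one_ne_zero
  have e2 : iteratedDeriv 2 g = deriv (deriv g) := by
    rw [iteratedDeriv_succ, iteratedDeriv_one]
  have e3 : iteratedDeriv 3 g = deriv (deriv (deriv g)) := by
    rw [iteratedDeriv_succ, e2]
  rw [e2, e3]
  refine ⟨?_, ?_, (d3.differentiableAt h0).hasDerivAt⟩
  · filter_upwards [h0] with x hx using (d1.differentiableAt (hI.mem_nhds hx)).hasDerivAt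
  · filter_upwards [h0] with x hx using (d2.differentiableAt (hI.mem_nhds hx)).hasDerivAt

/-- On some interval `(0, δ)` the period function is the minimal period of the cycle through
`(c, 0)`, and it is strictly monotonic there in the sense given by the sign of the quantity. -/
theorem theorem1 (a b : ℝ) (ha : a < 0) (hb : 0 < b) (f g : ℝ → ℝ)
    (hf : ContDiffOn ℝ 1 f (Icc a b)) (hg : ContDiffOn ℝ 3 g (Icc a b))
    (hf0 : f 0 = 0) (hg0 : g 0 = 0) (hg1 : 0 < deriv g 0)
    (hcenter : IsCenterAtOrigin f g (Icc a b)) :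
    ∃ δ : ℝ, 0 < δ ∧
      (∀ c ∈ Ioo 0 δ, ∃ z : ℝ → ℝ × ℝ, IsPhaseCurve f g (Icc a b) z ∧ z 0 = (c, 0) ∧
        IsLeast {τ : ℝ | 0 < τ ∧ Function.Periodic z τ} (periodFunction f g (Icc a b) c)) ∧
      (monotonicityQuantity f g ≠ 0 →
        StrictMonoOn (periodFunction f g (Icc a b)) (Ioo 0 δ) ∨
          StrictAntiOn (periodFunction f g (Icc a b)) (Ioo 0 δ)) ∧
      (monotonicityQuantity f g < 0 →
        StrictMonoOn (periodFunction f g (Icc a b)) (Ioo 0 δ)) ∧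
      (0 < monotonicityQuantity f g →
        StrictAntiOn (periodFunction f g (Icc a b)) (Ioo 0 δ)) := by
  have hab : a ≤ b := (ha.trans hb).le
  have h0mem : (0:ℝ) ∈ Icc a b := ⟨ha.le, hb.le⟩
  have hnhds : Icc a b ∈ 𝓝 (0:ℝ) := Icc_mem_nhds ha hb
  obtain ⟨D1, D2, D3⟩ := exists_derivatives ha hb hg
  have hg' : ContDiffOn ℝ 1 g (Icc a b) := hg.of_le (by norm_num)
  set ω := √(deriv g 0) with hωdef
  have hω : 0 < ω := Real.sqrt_pos.2 hg1
  have hω2 : ω ^ 2 = deriv g 0 := Real.sq_sqrt hg1.le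
  -- Continuous extensions to the line, constant outside [a, b]; neither the phase curves in [a, b]
  -- nor the derivatives at 0 are affected.
  set F : ℝ → ℝ := fun x => f (clamp a b x) with hFdef
  set G : ℝ → ℝ := fun x => g (clamp a b x) with hGdef
  have hFf : EqOn F f (Icc a b) := fun x hx => by simp only [hFdef, clamp_of_mem hx]
  have hGg : EqOn G g (Icc a b) := fun x hx => by simp only [hGdef, clamp_of_mem hx]
  have hF : Continuous F :=
    hf.continuousOn.comp_continuous (continuous_clamp a b) (clamp_mem hab)
  have hG : Continuous G :=
    hg.continuousOn.comp_continuous (continuous_clamp a b) (clamp_mem hab)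
  have hFe : F =ᶠ[𝓝 0] f := hFf.eventuallyEq_of_mem hnhds
  have hGe : G =ᶠ[𝓝 0] g := hGg.eventuallyEq_of_mem hnhds
  have hF0 : F 0 = 0 := (hFf h0mem).trans hf0
  have hG0 : G 0 = 0 := (hGg h0mem).trans hg0
  have hF1 : HasDerivAt F (deriv f 0) 0 :=
    (((hf.differentiableOn one_ne_zero).differentiableAt hnhds).hasDerivAt).congr_of_eventuallyEq hFe
  have hGd : ∀ᶠ x in 𝓝 0, HasDerivAt G (deriv g x) x := by
    filter_upwards [D1, hGe.eventuallyEq_nhds] with x h1 h2 using h1.congr_of_eventuallyEq h2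
  have hG1 : DifferentiableAt ℝ G 0 := hGd.self_of_nhds.differentiableAt
  obtain ⟨H', β', hexp⟩ := localExpansion_coeff ha hb hω hF hF0 hF1 hG0 hGd D2 D3 hω2
  set p₀ := iteratedDeriv 2 g 0 / (2 * ω ^ 3) with hp₀
  set p₁ := (iteratedDeriv 3 g 0 - 2 / 3 * deriv f 0 ^ 2) / (6 * ω ^ 4) with hp₁
  have hcH := continuous_restoringCoeff (a := a) (b := b) (ω := ω) hF hF0 hF1 hG hG1
  have hcβ := continuous_dampingCoeff (a := a) (b := b) (ω := ω) hF hF0 hF1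
  set I := 5 * Real.pi / 6 * p₀ ^ 2 - 3 * Real.pi / 4 * p₁ with hI
  -- The period grows with the amplitude when I > 0, that is when Q < 0.
  have hIQ : I = -(Real.pi / (8 * ω ^ 6)) * monotonicityQuantity f g := by
    rw [hI, hp₀, hp₁, monotonicityQuantity, ← hω2]
    field_simp
    ring
  have hcoef : 0 < Real.pi / (8 * ω ^ 6) := by positivity
  -- An error below |I| preserves the sign of the period difference. If I = 0, the default 1 still
  -- yields a δ on which the period is well defined.
  obtain ⟨ε, hε, hεI⟩ : ∃ ε > 0, I ≠ 0 → ε < |I| := by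
    by_cases h0 : I = 0
    · exact ⟨1, one_pos, fun h => absurd h0 h⟩
    · exact ⟨|I| / 2, half_pos (abs_pos.2 h0), fun h => half_lt_self (abs_pos.2 h)⟩
  obtain ⟨η₁, hη₁, hturn⟩ := hexp.exists_turnTime_sub_close hcH hcβ hε
  obtain ⟨η₂, hη₂, horder⟩ := hexp.exists_lt_of_abscissa_lt
  obtain ⟨δ, hδ, hcycle⟩ := exists_isNormalizedCycle hab hω hf hg' hcenter hFf hGg hF hF0 hF1
    hG hG0 hG1 hexp (lt_min hη₁ hη₂)
  have hdiff : ∀ c ∈ Ioo 0 δ, ∀ d ∈ Ioo 0 δ, c < d → ∃ Δ > 0,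
      |ω * (periodFunction f g (Icc a b) d - periodFunction f g (Icc a b) c) - I * Δ| ≤ ε * Δ := by
    intro c hc d hd hcd
    obtain ⟨z, r, hr⟩ := hcycle c hc
    obtain ⟨w, s, hs⟩ := hcycle d hd
    have hmono : ∀ {η' : ℝ} {r : ℝ → ℝ}, min η₁ η₂ ≤ η' →
        IsPolarOrbit (restoringCoeff a b ω F G) (dampingCoeff a b ω F) (min η₁ η₂) r →
        IsPolarOrbit (restoringCoeff a b ω F G) (dampingCoeff a b ω F) η' r :=
      fun hle hr φ => ⟨(hr φ).1, (hr φ).2.1.trans hle, (hr φ).2.2⟩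
    have hlt := horder r s (hmono (min_le_right _ _) hr.isPolarOrbit)
      (hmono (min_le_right _ _) hs.isPolarOrbit) (ω * c) (ω * d) (mul_pos hω hc.1)
      (mul_lt_mul_of_pos_left hcd hω) hr.abscissa hs.abscissa
    have h1 := hturn r s (hmono (min_le_left _ _) hr.isPolarOrbit)
      (hmono (min_le_left _ _) hs.isPolarOrbit) hlt
    have hr0 := (hr.isPolarOrbit 0).1
    refine ⟨s 0 ^ 2 - r 0 ^ 2, by nlinarith, ?_⟩
    rw [hr.periodFunction_eq, hs.periodFunction_eq]
    refine le_trans (le_of_eq ?_) h1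
    congr 2
    field_simp
  have hneg : monotonicityQuantity f g < 0 →
      StrictMonoOn (periodFunction f g (Icc a b)) (Ioo 0 δ) := by
    intro hQ c hc d hd hcd
    have hIpos : 0 < I := by
      rw [hIQ]
      exact mul_pos_of_neg_of_neg (neg_lt_zero.2 hcoef) hQ
    obtain ⟨Δ, hΔ, h1⟩ := hdiff c hc d hd hcd
    have h2 := hεI hIpos.ne'
    rw [abs_of_pos hIpos] at h2
    have h3 := mul_lt_mul_of_pos_right h2 hΔ
    have h4 := (abs_le.1 h1).1
    have h5 : 0 < ω * (periodFunction f g (Icc a b) d - periodFunction f g (Icc a b) c) := by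
      linarith
    exact sub_pos.1 ((mul_pos_iff_of_pos_left hω).1 h5)
  have hpos : 0 < monotonicityQuantity f g →
      StrictAntiOn (periodFunction f g (Icc a b)) (Ioo 0 δ) := by
    intro hQ c hc d hd hcd
    have hIneg : I < 0 := by
      rw [hIQ]
      exact mul_neg_of_neg_of_pos (neg_lt_zero.2 hcoef) hQ
    obtain ⟨Δ, hΔ, h1⟩ := hdiff c hc d hd hcd
    have h2 := hεI hIneg.ne
    rw [abs_of_neg hIneg] at h2
    have h3 := mul_lt_mul_of_pos_right h2 hΔ
    have h4 := (abs_le.1 h1).2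
    have h5 : 0 < ω * (periodFunction f g (Icc a b) c - periodFunction f g (Icc a b) d) := by
      linarith
    exact sub_pos.1 ((mul_pos_iff_of_pos_left hω).1 h5)
  refine ⟨δ, hδ, fun c hc => ?_, fun hQ => ?_, hneg, hpos⟩
  · obtain ⟨z, r, hz⟩ := hcycle c hc
    exact ⟨z, hz.isPhaseCurve, hz.apply_zero, by rw [hz.periodFunction_eq]; exact hz.isLeast⟩
  · rcases lt_or_gt_of_ne hQ with h | h
    · exact Or.inl (hneg h)
    · exact Or.inr (hpos h)
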